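/- Let $G$ be an abelian Lie group acting smoothly, freely and properly on a smooth (finite-dimensional, Hausdorff, second countable) manifold $Q$ without boundary, let $\mathfrak g$ be its Lie algebra, and let $S=Q/G$ be the quotient manifold (shape space) with projection $\pi:Q\to S$. For $\xi\in\mathfrak g$ let $\xi_Q$ be its infinitesimal generator on $Q$, and put $\operatorname{Ver}(q)=\{\xi_Q(q):\xi\in\mathfrak g\}\subset T_qQ$. Let $L_d:Q\times Q\to\mathbb R$ be smooth and invariant under the diagonal action of $G$. Assume that $L_d$ is regular (for every $q$ the bilinear form $D_2D_1L_d(q,q)$ on $T_qQ$ is nondegenerate) and group-regular (for every $q$ its restriction to $\operatorname{Ver}(q)\times\operatorname{Ver}(q)$ is nondegenerate). Let $\mathbf J_d:Q\times Q\to\mathfrak g^*$, $\mathbf J_d(q_0,q_1)\cdot\xi=D_2L_d(q_0,q_1)\cdot\xi_Q(q_1)$, be the discrete momentum map. Then there is a $G$-invariant open neighbourhood $W$ of the diagonal of $Q\times Q$ such that the following holds for every $\mu\in\mathfrak g^*$. (a) Put $J_\mu=W\cap\mathbf J_d^{-1}(\mu)$. The map $(q_0,q_1)\mapsto(\pi(q_0),\pi(q_1))$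 induces an injective map from $J_\mu/G$ to $S\times S$, whose image $D_\mu$ is open. There is a unique function $\hat L_d$ on $D_\mu$ with $\hat L_d(\pi(q_0),\pi(q_1))=L_d(q_0,q_1)$ for $(q_0,q_1)\in J_\mu$, and it is smooth. (b) Let $\mathfrak A$ be any principal connection on $Q\to S$, let $\mathfrak A_\mu=\langle\mu,\mathfrak A\rangle$, and let $\mathcal A=\pi_2^*\mathfrak A_\mu-\pi_1^*\mathfrak A_\mu$, where $\pi_1,\pi_2:Q\times Q\to Q$ are the projections. There is a unique $1$-form $\hat{\mathcal A}$ on $D_\mu$ whose pullback to $J_\mu$ is the restriction of $\mathcal A$ to $J_\mu$. Write $\hat{\mathcal A}(x_0,x_1)\cdot(\delta x_0,\delta x_1)=\hat{\mathcal A}_1(x_0,x_1)\cdot\delta x_0+\hat{\mathcal A}_2(x_0,x_1)\cdot\delta x_1$. (c) Let $\mathbf x=(x_0,\dots,x_n)$ be a discrete curve in $S$ and $\mathbf q=(q_0,\dots,q_n)$ a lift of $\mathbf x$ to $Q$ (so $\pi(q_k)=x_k$) with $(q_k,q_{k+1})\in W$ and $\mathbf J_d(q_k,q_{k+1})=\mu$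 for $0\le k<n$. Then the following are equivalent: 1. $\mathbf q$ solves the discrete Euler–Lagrange equations $D_2L_d(q_{k-1},q_k)+D_1L_d(q_k,q_{k+1})=0$ for $0<k<n$. 2. $\mathbf q$ satisfies the discrete Hamilton principle $\delta\sum_{k=0}^{n-1}L_d(q_k,q_{k+1})=0$ for all variations $\delta\mathbf q$ of $\mathbf q$ that vanish at the endpoints. 3. $\mathbf x$ solves the discrete Routh equations $D_2\hat L_d(x_{k-1},x_k)+D_1\hat L_d(x_k,x_{k+1})=\hat{\mathcal A}_2(x_{k-1},x_k)+\hat{\mathcal A}_1(x_k,x_{k+1})$ for $0<k<n$. 4. $\mathbf x$ satisfies the reduced variational principle $\delta\sum_{k=0}^{n-1}\hat L_d(x_k,x_{k+1})=\sum_{k=0}^{n-1}\hat{\mathcal A}(x_k,x_{k+1})\cdot(\delta x_k,\delta x_{k+1})$ for all variations $\delta\mathbf x$ of $\mathbf x$ that vanish at the endpoints. -/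

import Mathlib

open scoped Manifold ContDiff

noncomputable section

namespace DiscreteRouth

section Calculus

variable (E : Type*) [NormedAddCommGroup E] [NormedSpace ℝ E]
  {M : Type*} [TopologicalSpace M] [ChartedSpace E M]

/-- The derivative `D₁F(a, b) : T_a M → ℝ` of `F : M × M → ℝ` in the first slot. -/
def D₁ (F : M × M → ℝ) (a b : M) : TangentSpace 𝓘(ℝ, E) a →L[ℝ] ℝ :=
  mvfderiv 𝓘(ℝ, E) (fun a' : M => F (a', b)) a

/-- The derivative `D₂F(a, b) : T_b M → ℝ` of `F : M × M → ℝ` in the second slot. -/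
def D₂ (F : M × M → ℝ) (a b : M) : TangentSpace 𝓘(ℝ, E) b →L[ℝ] ℝ :=
  mvfderiv 𝓘(ℝ, E) (fun b' : M => F (a, b')) b

/-- The iterated derivative `D₂D₁F(a, b) : T_a M × T_b M → ℝ`: for fixed `v ∈ T_a M`, the
real function `b ↦ D₁F(a, b) · v` is differentiated at `b` in the direction `w ∈ T_b M`. -/
def D₂D₁ (F : M × M → ℝ) (a b : M)
    (v : TangentSpace 𝓘(ℝ, E) a) (w : TangentSpace 𝓘(ℝ, E) b) : ℝ :=
  mvfderiv 𝓘(ℝ, E) (fun b' : M => D₁ E F a b' v) b w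

/-- Regularity: `D₂D₁F(q, q)` is a nondegenerate bilinear form on `T_q M`, for every `q`. -/
def IsRegular (F : M × M → ℝ) : Prop :=
  ∀ q : M,
    (∀ v : TangentSpace 𝓘(ℝ, E) q,
      (∀ w : TangentSpace 𝓘(ℝ, E) q, D₂D₁ E F q q v w = 0) → v = 0) ∧
    (∀ w : TangentSpace 𝓘(ℝ, E) q,
      (∀ v : TangentSpace 𝓘(ℝ, E) q, D₂D₁ E F q q v w = 0) → w = 0)

/-- The velocity `d/dε|_{ε = 0} γ(ε)` of a curve `γ` in `M`. -/
def velocity (γ : ℝ → M) : TangentSpace 𝓘(ℝ, E) (γ 0) :=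
  mfderiv 𝓘(ℝ, ℝ) 𝓘(ℝ, E) γ 0 (1 : ℝ)

/-- `c` is a variation, with infinitesimal variation vanishing at the endpoints, of the discrete
curve `q 0, …, q n`: each `ε ↦ c k ε` is a curve, smooth near `ε = 0`, through `q k` at `ε = 0`,
and `δq₀ = 0`, `δqₙ = 0`, where `δq_k` is the velocity of `c k` at `ε = 0`. -/
structure IsVariation (n : ℕ) (q : ℕ → M) (c : ℕ → ℝ → M) : Prop where
  smooth : ∀ k ≤ n, ∃ r > 0,
    ContMDiffOn 𝓘(ℝ, ℝ) 𝓘(ℝ, E) ∞ (c k) (Set.Ioo (-r) r)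
  base : ∀ k ≤ n, c k 0 = q k
  left_end : velocity E (c 0) = 0
  right_end : velocity E (c n) = 0

/-- The discrete Euler–Lagrange equations
`D₂F(q_{k-1}, q_k) + D₁F(q_k, q_{k+1}) = 0`, `0 < k < n`, for the curve `q 0, …, q n`. -/
def SolvesDEL (F : M × M → ℝ) (n : ℕ) (q : ℕ → M) : Prop :=
  ∀ k : ℕ, k + 1 < n →
    D₂ E F (q k) (q (k + 1)) + D₁ E F (q (k + 1)) (q (k + 2)) = 0

/-- The discrete Hamilton principle `δ ∑ F(q_k, q_{k+1}) = 0` for all variations of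
`q 0, …, q n` that vanish at the endpoints. -/
def SolvesHamilton (F : M × M → ℝ) (n : ℕ) (q : ℕ → M) : Prop :=
  ∀ c : ℕ → ℝ → M, IsVariation E n q c →
    HasDerivAt (fun ε : ℝ => ∑ k ∈ Finset.range n, F (c k ε, c (k + 1) ε)) 0 0

/-- A (not necessarily continuous) `1`-form on `M × M`, with
`T_{(a, b)}(M × M) = T_a M × T_b M`. -/
abbrev PairForm (M : Type*) [TopologicalSpace M] [ChartedSpace E M] : Type _ :=
  ∀ a b : M, (TangentSpace 𝓘(ℝ, E) a × TangentSpace 𝓘(ℝ, E) b) →ₗ[ℝ] ℝ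

/-- The discrete Routh equations
`D₂F(x_{k-1}, x_k) + D₁F(x_k, x_{k+1}) = α₂(x_{k-1}, x_k) + α₁(x_k, x_{k+1})`, `0 < k < n`,
where `α(a, b)·(v, w) = α₁(a, b)·v + α₂(a, b)·w`. -/
def SolvesDR (F : M × M → ℝ) (α : PairForm E M) (n : ℕ) (x : ℕ → M) : Prop :=
  ∀ k : ℕ, k + 1 < n → ∀ v : TangentSpace 𝓘(ℝ, E) (x (k + 1)),
    D₂ E F (x k) (x (k + 1)) v + D₁ E F (x (k + 1)) (x (k + 2)) v
      = α (x k) (x (k + 1)) (0, v) + α (x (k + 1)) (x (k + 2)) (v, 0)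

/-- The reduced variational principle
`δ ∑ F(x_k, x_{k+1}) = ∑ α(x_k, x_{k+1})·(δx_k, δx_{k+1})` for all variations of `x 0, …, x n`
that vanish at the endpoints. (Here `c k 0 = x k`.) -/
def SolvesReducedPrinciple (F : M × M → ℝ) (α : PairForm E M) (n : ℕ) (x : ℕ → M) : Prop :=
  ∀ c : ℕ → ℝ → M, IsVariation E n x c →
    HasDerivAt (fun ε : ℝ => ∑ k ∈ Finset.range n, F (c k ε, c (k + 1) ε))
      (∑ k ∈ Finset.range n,
        α (c k 0) (c (k + 1) 0) (velocity E (c k), velocity E (c (k + 1)))) 0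

end Calculus

section Symmetry

/-- Shape space `S = Q / G`, with the quotient topology. -/
abbrev ShapeSpace (G Q : Type*) [CommGroup G] [MulAction G Q] : Type _ :=
  MulAction.orbitRel.Quotient G Q

/-- The projection `π : Q → S`, `q ↦ [q]`. -/
def proj (G : Type*) {Q : Type*} [CommGroup G] [MulAction G Q] (q : Q) : ShapeSpace G Q :=
  Quotient.mk (MulAction.orbitRel G Q) q

variable (EG : Type*) [NormedAddCommGroup EG] [NormedSpace ℝ EG]
  (EQ : Type*) [NormedAddCommGroup EQ] [NormedSpace ℝ EQ]
  (ES : Type*) [NormedAddCommGroup ES] [NormedSpace ℝ ES]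
  (G : Type*) [TopologicalSpace G] [ChartedSpace EG G] [CommGroup G]
  {Q : Type*} [TopologicalSpace Q] [ChartedSpace EQ Q] [MulAction G Q]

/-- The Lie algebra `𝔤 = T₁G`. -/
abbrev LieAlg : Type _ := GroupLieAlgebra 𝓘(ℝ, EG) G

/-- The infinitesimal generator `ξ_Q(q)`: the derivative at `1` of `g ↦ g • q`, applied
to `ξ ∈ 𝔤`. -/
def generator (q : Q) : LieAlg EG G →L[ℝ] TangentSpace 𝓘(ℝ, EQ) q :=
  mfderiv 𝓘(ℝ, EG) 𝓘(ℝ, EQ) (fun g : G => g • q) 1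

/-- The vertical space `Ver(q) = {ξ_Q(q) : ξ ∈ 𝔤}`. -/
def Ver (q : Q) : Submodule ℝ (TangentSpace 𝓘(ℝ, EQ) q) :=
  LinearMap.range (generator EG EQ G q).toLinearMap

/-- Group-regularity: the restriction of `D₂D₁L(q, q)` to `Ver(q) × Ver(q)` is nondegenerate,
for every `q`. -/
def IsGroupRegular (L : Q × Q → ℝ) : Prop :=
  ∀ q : Q,
    (∀ v ∈ Ver EG EQ G q, (∀ w ∈ Ver EG EQ G q, D₂D₁ EQ L q q v w = 0) → v = 0) ∧
    (∀ w ∈ Ver EG EQ G q, (∀ v ∈ Ver EG EQ G q, D₂D₁ EQ L q q v w = 0) → w = 0)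

/-- The discrete momentum map `J_d(q₀, q₁)·ξ = D₂L(q₀, q₁)·ξ_Q(q₁)`. -/
def Jd (L : Q × Q → ℝ) (q₀ q₁ : Q) : LieAlg EG G →L[ℝ] ℝ :=
  (D₂ EQ L q₀ q₁).comp (generator EG EQ G q₁)

/-- The part in `W ⊆ Q × Q` of the momentum level set `J_d⁻¹(μ)`. -/
def levelSet (L : Q × Q → ℝ) (W : Set (Q × Q)) (μ : LieAlg EG G →L[ℝ] ℝ) : Set (Q × Q) :=
  {p | p ∈ W ∧ Jd EG EQ G L p.1 p.2 = μ}

/-- `(w₀, w₁) ∈ T_{(q₀, q₁)}(Q × Q)` is tangent to the level set of `J_d` through `(q₀, q₁)`: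
it is annihilated by the derivative of `J_d`, that is, of all `J_d(·)·ξ`, `ξ ∈ 𝔤`. -/
def IsTangentToLevel (L : Q × Q → ℝ) (q₀ q₁ : Q)
    (w₀ : TangentSpace 𝓘(ℝ, EQ) q₀) (w₁ : TangentSpace 𝓘(ℝ, EQ) q₁) : Prop :=
  ∀ ξ : LieAlg EG G,
    mvfderiv (𝓘(ℝ, EQ).prod 𝓘(ℝ, EQ))
      (fun p : Q × Q => Jd EG EQ G L p.1 p.2 ξ) (q₀, q₁) (w₀, w₁) = 0

/-- The manifold structure on `S = Q / G` is that of the quotient manifold: the projection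
is a smooth submersion. There is at most one such smooth structure. -/
structure IsQuotientManifold (Q : Type*) [TopologicalSpace Q] [ChartedSpace EQ Q]
    [MulAction G Q] [ChartedSpace ES (ShapeSpace G Q)] : Prop where
  isManifold : IsManifold 𝓘(ℝ, ES) ∞ (ShapeSpace G Q)
  smooth : ContMDiff 𝓘(ℝ, EQ) 𝓘(ℝ, ES) ∞ (proj G : Q → ShapeSpace G Q)
  submersion : ∀ q : Q,
    Function.Surjective (mfderiv 𝓘(ℝ, EQ) 𝓘(ℝ, ES) (proj G : Q → ShapeSpace G Q) q)

/-- A principal connection on `Q → Q / G` for an abelian group `G`: a smooth `𝔤`-valued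
`1`-form `𝔄` on `Q` with `𝔄(ξ_Q(q)) = ξ` that is invariant (the adjoint action is trivial). -/
structure PrincipalConnection (Q : Type*) [TopologicalSpace Q] [ChartedSpace EQ Q]
    [IsManifold 𝓘(ℝ, EQ) 1 Q] [MulAction G Q] where
  form : ∀ q : Q, TangentSpace 𝓘(ℝ, EQ) q →L[ℝ] LieAlg EG G
  smooth : ContMDiff (M' := EG) 𝓘(ℝ, EQ).tangent 𝓘(ℝ, EG) ∞
    (fun v : TangentBundle 𝓘(ℝ, EQ) Q => form v.proj v.2)
  reproduces : ∀ (q : Q) (ξ : LieAlg EG G), form q (generator EG EQ G q ξ) = ξ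
  invariant : ∀ (g : G) (q : Q) (v : TangentSpace 𝓘(ℝ, EQ) q),
    form (g • q) (mfderiv 𝓘(ℝ, EQ) 𝓘(ℝ, EQ) (fun q' : Q => g • q') q v) = form q v

/-- The `1`-form `𝒜 = π₂^*𝔄_μ − π₁^*𝔄_μ` on `Q × Q`, where `𝔄_μ(q)·v = ⟨μ, 𝔄(q)·v⟩`. -/
def calA [IsManifold 𝓘(ℝ, EQ) 1 Q] (A : PrincipalConnection EG EQ G Q)
    (μ : LieAlg EG G →L[ℝ] ℝ) (q₀ q₁ : Q)
    (w₀ : TangentSpace 𝓘(ℝ, EQ) q₀) (w₁ : TangentSpace 𝓘(ℝ, EQ) q₁) : ℝ :=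
  μ (A.form q₁ w₁) - μ (A.form q₀ w₀)

/-- The map `(q₀, q₁) ↦ ([q₀], [q₁])` from `Q × Q` to `S × S`; on `J_d⁻¹(μ)` it
induces `φ_μ : J_d⁻¹(μ) / G → S × S`. -/
def phi (p : Q × Q) : ShapeSpace G Q × ShapeSpace G Q := (proj G p.1, proj G p.2)

/-- The discrete reduced Lagrangian `L̂ : S × S → ℝ`, induced by the restriction of `L` to
`W ∩ J_d⁻¹(μ)`: its value at `(x₀, x₁)` is `L(q₀, q₁)` for a lift `(q₀, q₁)` of `(x₀, x₁)` to
`W ∩ J_d⁻¹(μ)` (and `0` if there is no lift). -/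
def reducedLagrangian (L : Q × Q → ℝ) (W : Set (Q × Q)) (μ : LieAlg EG G →L[ℝ] ℝ) :
    ShapeSpace G Q × ShapeSpace G Q → ℝ :=
  Function.extend (fun p : levelSet EG EQ G L W μ => phi G p.1) (fun p => L p.1) 0

variable [ChartedSpace ES (ShapeSpace G Q)]

/-- The `1`-form `α` on `S × S` is dropped from the restriction of `𝒜` to `W ∩ J_d⁻¹(μ)`:
the pullback of `α` under `(q₀, q₁) ↦ ([q₀], [q₁])` agrees with `𝒜` on all vectors tangent
to the level set. -/
def IsDroppedForm [IsManifold 𝓘(ℝ, EQ) 1 Q] (L : Q × Q → ℝ) (W : Set (Q × Q))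
    (μ : LieAlg EG G →L[ℝ] ℝ) (A : PrincipalConnection EG EQ G Q)
    (α : PairForm ES (ShapeSpace G Q)) : Prop :=
  ∀ q₀ q₁ : Q, (q₀, q₁) ∈ levelSet EG EQ G L W μ →
    ∀ (w₀ : TangentSpace 𝓘(ℝ, EQ) q₀) (w₁ : TangentSpace 𝓘(ℝ, EQ) q₁),
      IsTangentToLevel EG EQ G L q₀ q₁ w₀ w₁ →
        α (proj G q₀) (proj G q₁)
          (mfderiv 𝓘(ℝ, EQ) 𝓘(ℝ, ES) (proj G : Q → ShapeSpace G Q) q₀ w₀,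
           mfderiv 𝓘(ℝ, EQ) 𝓘(ℝ, ES) (proj G : Q → ShapeSpace G Q) q₁ w₁)
          = calA EG EQ G A μ q₀ q₁ w₀ w₁

open Classical in
/-- The reduced `1`-form `𝒜̂` on `S × S`: the form dropped from `𝒜` restricted to
`W ∩ J_d⁻¹(μ)` (the zero form, if there is none). -/
def reducedForm [IsManifold 𝓘(ℝ, EQ) 1 Q] (L : Q × Q → ℝ) (W : Set (Q × Q))
    (μ : LieAlg EG G →L[ℝ] ℝ) (A : PrincipalConnection EG EQ G Q) :
    PairForm ES (ShapeSpace G Q) :=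
  if h : ∃ α, IsDroppedForm EG EQ ES G L W μ A α then h.choose else fun _ _ => 0

end Symmetry

end DiscreteRouth

end

/-!
Write `J` for the discrete momentum map. Invariance of `L` along the diagonal action gives
`J(q₀, q₁)·ξ = -D₁L(q₀, q₁)·ξ_Q(q₀)`, so on the diagonal the derivative of `J` in the second slot
along the orbit is minus the form `D₂D₁L` on vertical vectors (`momentumDeriv_diag`). A free action
is infinitesimally free (`gen_injective`), so group-regularity makes this derivative invertible, on
the diagonal and, the condition being open, near it. Two things follow.

* By the inverse function theorem, `g ↦ J(q₀, g • q₁)` is locally injective near the diagonal.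
  Properness and freeness rule out group elements far from `1`, and paracompactness of shape space
  glues the local statements to an invariant neighbourhood `W`
  (`exists_isOpen_momentum_injective`). Hence two points of `W ∩ J⁻¹(μ)` over the same point of
  `S × S` differ by the diagonal action (`exists_smul_eq_of_phi_eq`).
* The map `(π × π, J)` is a submersion on `W`, so `π × π` has smooth local sections with values in
  `W ∩ J⁻¹(μ)` (`exists_levelSet_section`). The image of the level set is therefore open, and `L̂`,
  locally the composition of `L` with such a section, is smooth.

The kernel of `Tπ` is the vertical space (`exists_gen_eq_of_td_proj_eq_zero`), so a vector tangent
to the level set with trivial projection to `S × S` comes from the diagonal action, and `𝒜` vanishes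
on it. This and the invariance of `𝒜` make `𝒜` drop to `𝒜̂` (`isDroppedForm_reducedForm`).

For the equations of motion, the point is that `dL - 𝒜` is the pullback of `dL̂ - 𝒜̂` at every point
of the level set *on all vectors*, not only on tangent ones (`td_lagrangian_sub_connectionDiff`),
because `dL(0, η_Q) = ⟨J, η⟩ = ⟨μ, η⟩ = 𝒜(0, η_Q)`. Adding this identity for two consecutive pairs,
the terms with `𝔄_μ` at the middle point cancel: the discrete Euler–Lagrange expression of `q` at
`w` is the discrete Routh expression of `x` at `Tπ w`. Both variational principles are the
corresponding equations by summation by parts (`solvesDR_iff_solvesReducedPrinciple`).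
-/

open scoped Manifold ContDiff

namespace DiscreteRouth

open Set Filter Topology

/-! ### Local inverses of smooth maps -/

section LocalInverses

variable {E F : Type*} [NormedAddCommGroup E] [NormedSpace ℝ E]
  [NormedAddCommGroup F] [NormedSpace ℝ F]

theorem exists_contDiffAt_rightInverse [CompleteSpace E] [FiniteDimensional ℝ F] {f : E → F} {a : E}
    (hf : ContDiffAt ℝ ∞ f a) (hs : Function.Surjective (fderiv ℝ f a)) :
    ∃ σ : F → E, ContDiffAt ℝ ∞ σ (f a) ∧ σ (f a) = a ∧ ∀ᶠ y in 𝓝 (f a), f (σ y) = y := by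
  have : CompleteSpace F := FiniteDimensional.complete ℝ F
  obtain ⟨R, hR⟩ := ContinuousLinearMap.exists_rightInverse_of_surjective (fderiv ℝ f a)
    (LinearMap.range_eq_top.2 hs)
  -- on the affine subspace through `a` parametrized by `R`, the derivative of `f` is the identity
  let j : F → E := fun y => a + R y
  have hj : ContDiff ℝ ∞ j := contDiff_const.add R.contDiff
  have hj0 : j 0 = a := by simp [j]
  have hfj : ContDiffAt ℝ ∞ f (j 0) := by rwa [hj0]
  let h : F → F := fun y => f (j y)
  have hh : ContDiffAt ℝ ∞ h 0 := hfj.comp 0 hj.contDiffAt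
  have hjd : HasFDerivAt j R 0 := R.hasFDerivAt.const_add a
  have hh' : HasFDerivAt h ((ContinuousLinearEquiv.refl ℝ F : F ≃L[ℝ] F) : F →L[ℝ] F) 0 := by
    have h1 := (hfj.differentiableAt (by simp)).hasFDerivAt.comp (0 : F) hjd
    rw [hj0, hR] at h1
    exact h1
  have h0 : h 0 = f a := by simp [h, hj0]
  refine ⟨fun y => j (hh.localInverse hh' (by simp) y), ?_, ?_, ?_⟩
  · have := hh.to_localInverse hh' (by simp)
    rw [h0] at this
    exact hj.contDiffAt.comp _ this
  · have := hh.localInverse_apply_image hh' (by simp)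
    rw [h0] at this
    simp only [this, hj0]
  · have := (hh.toOpenPartialHomeomorph h hh' (by simp)).eventually_right_inverse'
      (hh.mem_toOpenPartialHomeomorph_source hh' (by simp))
    have e : (hh.toOpenPartialHomeomorph h hh' (by simp)) 0 = f a := h0
    rw [e] at this
    exact this

theorem exists_contDiffAt_leftInverse [FiniteDimensional ℝ E] [FiniteDimensional ℝ F]
    {f : E → F} {a : E} (hf : ContDiffAt ℝ ∞ f a) (hs : Function.Injective (fderiv ℝ f a)) :
    ∃ ρ : F → E, ContDiffAt ℝ ∞ ρ (f a) ∧ ∀ᶠ x in 𝓝 a, ρ (f x) = x := by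
  have : CompleteSpace E := FiniteDimensional.complete ℝ E
  obtain ⟨L₀, hL₀⟩ := LinearMap.exists_leftInverse_of_injective
    (fderiv ℝ f a : E →ₗ[ℝ] F) (LinearMap.ker_eq_bot.2 hs)
  let L : F →L[ℝ] E := LinearMap.toContinuousLinearMap L₀
  have hL : L.comp (fderiv ℝ f a) = ContinuousLinearMap.id ℝ E := by
    ext v; exact LinearMap.congr_fun hL₀ v
  -- after composition with `L`, the derivative is the identity
  let h : E → E := fun x => L (f x)
  have hh : ContDiffAt ℝ ∞ h a := L.contDiff.contDiffAt.comp a hf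
  have hh' : HasFDerivAt h ((ContinuousLinearEquiv.refl ℝ E : E ≃L[ℝ] E) : E →L[ℝ] E) a := by
    have h1 := L.hasFDerivAt.comp a (hf.differentiableAt (by simp)).hasFDerivAt
    rw [hL] at h1
    exact h1
  refine ⟨fun y => hh.localInverse hh' (by simp) (L y), ?_, ?_⟩
  · have : ContDiffAt ℝ ∞ (hh.localInverse hh' (by simp)) (L (f a)) :=
      hh.to_localInverse hh' (by simp)
    exact this.comp (f a) L.contDiff.contDiffAt
  · exact (hh.toOpenPartialHomeomorph h hh' (by simp)).eventually_left_inverse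
      (hh.mem_toOpenPartialHomeomorph_source hh' (by simp))

end LocalInverses

/-! ### Derivatives read in the model spaces -/

section TangentMap

variable {E : Type*} [NormedAddCommGroup E] [NormedSpace ℝ E]
  {H : Type*} [TopologicalSpace H] (I : ModelWithCorners ℝ E H)
  {M : Type*} [TopologicalSpace M] [ChartedSpace H M]
  {E' : Type*} [NormedAddCommGroup E'] [NormedSpace ℝ E']
  {H' : Type*} [TopologicalSpace H'] (I' : ModelWithCorners ℝ E' H')
  {M' : Type*} [TopologicalSpace M'] [ChartedSpace H' M']
  {E'' : Type*} [NormedAddCommGroup E''] [NormedSpace ℝ E'']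
  {H'' : Type*} [TopologicalSpace H''] (I'' : ModelWithCorners ℝ E'' H'')
  {M'' : Type*} [TopologicalSpace M''] [ChartedSpace H'' M'']

/-- The derivative of a map between manifolds, as a linear map between the model vector spaces.
A tangent space `T_x M` is by definition the model space of `M`; forgetting the base point makes
it possible to rewrite base points. -/
noncomputable def td (f : M → M') (x : M) : E →L[ℝ] E' := mfderiv I I' f x

variable {I I' I''}

theorem td_comp {g : M' → M''} {f : M → M'} {x : M} (hg : MDifferentiableAt I' I'' g (f x))
    (hf : MDifferentiableAt I I' f x) :
    td I I'' (fun y => g (f y)) x = (td I' I'' g (f x)).comp (td I I' f x) :=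
  mfderiv_comp x hg hf

theorem td_comp_of_eq {g : M' → M''} {f : M → M'} {x : M} {y : M'}
    (hg : MDifferentiableAt I' I'' g y)
    (hf : MDifferentiableAt I I' f x) (h : f x = y) :
    td I I'' (fun y => g (f y)) x = (td I' I'' g y).comp (td I I' f x) := by
  subst h; exact td_comp hg hf

theorem td_const (x : M) (y : M') : td I I' (fun _ => y) x = 0 := mfderiv_const

theorem td_id (x : M) : td I I (fun y => y) x = ContinuousLinearMap.id ℝ E := mfderiv_id

theorem td_congr {f g : M → M'} {x : M} (h : f =ᶠ[𝓝 x] g) : td I I' f x = td I I' g x :=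
  h.mfderiv_eq

theorem td_prodMk {f : M → M'} {g : M → M''} {x : M} (hf : MDifferentiableAt I I' f x)
    (hg : MDifferentiableAt I I'' g x) :
    td I (I'.prod I'') (fun y => (f y, g y)) x = (td I I' f x).prod (td I I'' g x) :=
  mfderiv_prodMk hf hg

theorem td_prod_apply {f : M × M' → M''} {a : M} {b : M'}
    (hf : MDifferentiableAt (I.prod I') I'' f (a, b)) (v : E) (w : E') :
    td (I.prod I') I'' f (a, b) (v, w)
      = td I I'' (fun x => f (x, b)) a v + td I' I'' (fun y => f (a, y)) b w :=
  mfderiv_prod_eq_add_apply hf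

theorem td_fst (p : M × M') : td (I.prod I') I (fun y : M × M' => y.1) p =
    ContinuousLinearMap.fst ℝ E E' := mfderiv_fst

theorem td_snd (p : M × M') : td (I.prod I') I' (fun y : M × M' => y.2) p =
    ContinuousLinearMap.snd ℝ E E' := mfderiv_snd

theorem mdifferentiableAt_clm (A : E →L[ℝ] E') (x : E) :
    MDifferentiableAt 𝓘(ℝ, E) 𝓘(ℝ, E') (fun y => A y) x :=
  A.differentiableAt.mdifferentiableAt

theorem td_clm (A : E →L[ℝ] E') (x : E) : td 𝓘(ℝ, E) 𝓘(ℝ, E') (fun y => A y) x = A :=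
  A.mfderiv_eq

theorem td_eq_fderiv [I.Boundaryless] [I'.Boundaryless] {f : M → M'} {x : M}
    (hf : MDifferentiableAt I I' f x) :
    td I I' f x = fderiv ℝ (writtenInExtChartAt I I' x f) (extChartAt I x x) := by
  have := hf.mfderiv
  rw [I.range_eq_univ, fderivWithin_univ] at this
  exact this

theorem contDiffAt_writtenInExtChartAt [I.Boundaryless] {n : ℕ∞ω}
    {f : M → M'} {x : M} (hf : ContMDiffAt I I' n f x) :
    ContDiffAt ℝ n (writtenInExtChartAt I I' x f) (extChartAt I x x) := by
  have := (contMDiffAt_iff.1 hf).2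
  rw [I.range_eq_univ, contDiffWithinAt_univ] at this
  exact this

variable [IsManifold I ∞ M] [I.Boundaryless] [I'.Boundaryless]

/-- A smooth map has a smooth local right inverse at a point where it is a submersion. -/
theorem exists_contMDiffAt_rightInverse [IsManifold I' ∞ M'] [CompleteSpace E]
    [FiniteDimensional ℝ E'] {f : M → M'} {x : M} (hf : ContMDiffAt I I' ∞ f x) (hs : Function.Surjective (td I I' f x)) :
    ∃ σ : M' → M, ContMDiffAt I' I ∞ σ (f x) ∧ σ (f x) = x ∧ ∀ᶠ y in 𝓝 (f x), f (σ y) = y := by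
  have hmd : MDifferentiableAt I I' f x := hf.mdifferentiableAt (by simp)
  rw [td_eq_fderiv hmd] at hs
  obtain ⟨σ, hσ, hσ0, hσr⟩ :=
    exists_contDiffAt_rightInverse (contDiffAt_writtenInExtChartAt hf) hs
  have e0 : writtenInExtChartAt I I' x f (extChartAt I x x) = extChartAt I' (f x) (f x) := by
    simp [writtenInExtChartAt]
  rw [e0] at hσ hσ0 hσr
  let τ : M' → M := fun y => (extChartAt I x).symm (σ (extChartAt I' (f x) y))
  have hτ0 : τ (f x) = x := by simp only [τ, hσ0, extChartAt_to_inv]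
  have hτ : ContMDiffAt I' I ∞ τ (f x) := by
    have h1 : ContMDiffAt I' 𝓘(ℝ, E') ∞ (extChartAt I' (f x)) (f x) := contMDiffAt_extChartAt
    have h2 : ContMDiffAt I' 𝓘(ℝ, E) ∞ (fun y => σ (extChartAt I' (f x) y)) (f x) :=
      hσ.contMDiffAt.comp (f x) h1
    have h3 : ContMDiffAt 𝓘(ℝ, E) I ∞ (extChartAt I x).symm (σ (extChartAt I' (f x) (f x))) := by
      rw [hσ0]
      exact (contMDiffOn_extChartAt_symm x).contMDiffAt (extChartAt_target_mem_nhds x)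
    exact h3.comp (f x) h2
  refine ⟨τ, hτ, hτ0, ?_⟩
  have c1 : ContinuousAt (extChartAt I' (f x)) (f x) := continuousAt_extChartAt (f x)
  have c2 : ContinuousAt (fun y => f (τ y)) (f x) :=
    ContinuousAt.comp (by rw [hτ0]; exact hf.continuousAt) hτ.continuousAt
  have c2' : Tendsto (fun y => f (τ y)) (𝓝 (f x)) (𝓝 (f x)) := by
    have := c2.tendsto
    rwa [hτ0] at this
  filter_upwards [c1.tendsto.eventually hσr, extChartAt_source_mem_nhds (I := I') (f x),
    c2'.eventually (extChartAt_source_mem_nhds (I := I') (f x))] with y h1 h2 h3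
  exact (extChartAt I' (f x)).injOn h3 h2 h1

/-- A smooth map has a smooth local left inverse at a point where it is an immersion. -/
theorem exists_contMDiffAt_leftInverse [FiniteDimensional ℝ E] [FiniteDimensional ℝ E']
    {f : M → M'} {x : M} (hf : ContMDiffAt I I' ∞ f x) (hs : Function.Injective (td I I' f x)) :
    ∃ ρ : M' → M, ContMDiffAt I' I ∞ ρ (f x) ∧ ∀ᶠ y in 𝓝 x, ρ (f y) = y := by
  have hmd : MDifferentiableAt I I' f x := hf.mdifferentiableAt (by simp)
  rw [td_eq_fderiv hmd] at hs
  obtain ⟨ρ, hρ, hρl⟩ :=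
    exists_contDiffAt_leftInverse (contDiffAt_writtenInExtChartAt hf) hs
  have e0 : writtenInExtChartAt I I' x f (extChartAt I x x) = extChartAt I' (f x) (f x) := by
    simp [writtenInExtChartAt]
  have hρ0 := hρl.self_of_nhds
  rw [e0] at hρ hρ0
  refine ⟨fun y => (extChartAt I x).symm (ρ (extChartAt I' (f x) y)), ?_, ?_⟩
  · have h1 : ContMDiffAt I' 𝓘(ℝ, E') ∞ (extChartAt I' (f x)) (f x) := contMDiffAt_extChartAt
    have h2 : ContMDiffAt I' 𝓘(ℝ, E) ∞ (fun y => ρ (extChartAt I' (f x) y)) (f x) :=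
      hρ.contMDiffAt.comp (f x) h1
    have h3 : ContMDiffAt 𝓘(ℝ, E) I ∞ (extChartAt I x).symm (ρ (extChartAt I' (f x) (f x))) := by
      rw [hρ0]
      exact (contMDiffOn_extChartAt_symm x).contMDiffAt (extChartAt_target_mem_nhds x)
    exact h3.comp (f x) h2
  · filter_upwards [(continuousAt_extChartAt (I := I) x).tendsto.eventually hρl,
      extChartAt_source_mem_nhds (I := I) x] with y h1 h2
    rw [writtenInExtChartAt, Function.comp_apply, Function.comp_apply,
      (extChartAt I x).left_inv h2] at h1
    rw [h1, (extChartAt I x).left_inv h2]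

/-- Every tangent vector is the velocity of a smooth curve. -/
theorem exists_curve_td_eq {E : Type*} [NormedAddCommGroup E] [NormedSpace ℝ E]
    {M : Type*} [TopologicalSpace M] [ChartedSpace E M] [IsManifold 𝓘(ℝ, E) ∞ M] (x : M) (v : E) :
    ∃ γ : ℝ → M, γ 0 = x ∧ (∃ r > 0, ContMDiffOn 𝓘(ℝ, ℝ) 𝓘(ℝ, E) ∞ γ (Ioo (-r) r)) ∧
      td 𝓘(ℝ, ℝ) 𝓘(ℝ, E) γ 0 1 = v := by
  -- a straight line in the chart at `x`
  let l : ℝ → E := fun t => extChartAt 𝓘(ℝ, E) x x + t • v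
  have hl : ContDiff ℝ ∞ l := by fun_prop
  have hl0 : l 0 = extChartAt 𝓘(ℝ, E) x x := by simp [l]
  let γ : ℝ → M := fun t => (extChartAt 𝓘(ℝ, E) x).symm (l t)
  have hγ0 : γ 0 = x := by simp only [γ, hl0, extChartAt_to_inv]
  have hev : ∀ᶠ t in 𝓝 (0 : ℝ), l t ∈ (extChartAt 𝓘(ℝ, E) x).target := by
    apply hl.continuous.continuousAt.eventually_mem
    rw [hl0]
    exact extChartAt_target_mem_nhds x
  obtain ⟨r, hr, hsub⟩ := Metric.eventually_nhds_iff_ball.1 hev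
  rw [Real.ball_eq_Ioo, zero_sub, zero_add] at hsub
  have hsm : ContMDiffOn 𝓘(ℝ, ℝ) 𝓘(ℝ, E) ∞ γ (Ioo (-r) r) :=
    (contMDiffOn_extChartAt_symm x).comp hl.contMDiff.contMDiffOn hsub
  refine ⟨γ, hγ0, ⟨r, hr, hsm⟩, ?_⟩
  have hd : MDifferentiableAt 𝓘(ℝ, ℝ) 𝓘(ℝ, E) γ 0 :=
    (hsm.contMDiffAt (Ioo_mem_nhds (by linarith) hr)).mdifferentiableAt (by simp)
  rw [td_eq_fderiv hd]
  have h1 : writtenInExtChartAt 𝓘(ℝ, ℝ) 𝓘(ℝ, E) 0 γ =ᶠ[𝓝 0] l := by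
    filter_upwards [hev] with t ht
    simp only [writtenInExtChartAt, Function.comp_apply, hγ0, extChartAt_model_space_eq_id,
      PartialEquiv.refl_symm, PartialEquiv.refl_coe, id]
    exact (extChartAt 𝓘(ℝ, E) x).right_inv ht
  have h2 : HasFDerivAt l (ContinuousLinearMap.toSpanSingleton ℝ v) 0 := 
    ((ContinuousLinearMap.toSpanSingleton ℝ v).hasFDerivAt (x := 0)).const_add
      (extChartAt 𝓘(ℝ, E) x x)
  have h3 : extChartAt 𝓘(ℝ, ℝ) (0 : ℝ) 0 = 0 := rfl
  rw [h3, h1.fderiv_eq, h2.fderiv]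
  simp

/-- Derivative of a function of two points along a pair of curves. -/
theorem hasDerivAt_comp_prodMk {E : Type*} [NormedAddCommGroup E] [NormedSpace ℝ E]
    {M : Type*} [TopologicalSpace M] [ChartedSpace E M] {F : M × M → ℝ} {c d : ℝ → M}
    {a b : M} (hF : MDifferentiableAt (𝓘(ℝ, E).prod 𝓘(ℝ, E)) 𝓘(ℝ, ℝ) F (a, b))
    (hc : MDifferentiableAt 𝓘(ℝ, ℝ) 𝓘(ℝ, E) c 0) (hd : MDifferentiableAt 𝓘(ℝ, ℝ) 𝓘(ℝ, E) d 0)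
    (hca : c 0 = a) (hdb : d 0 = b) :
    HasDerivAt (fun ε => F (c ε, d ε))
      (D₁ E F a b (td 𝓘(ℝ, ℝ) 𝓘(ℝ, E) c 0 1) + D₂ E F a b (td 𝓘(ℝ, ℝ) 𝓘(ℝ, E) d 0 1)) 0 := by
  have h0 : (c 0, d 0) = (a, b) := by rw [hca, hdb]
  have h1 := td_comp_of_eq (f := fun ε => (c ε, d ε)) hF (hc.prodMk hd) h0
  rw [td_prodMk hc hd] at h1
  have hm : MDifferentiableAt 𝓘(ℝ, ℝ) 𝓘(ℝ, ℝ) (fun ε => F (c ε, d ε)) 0 :=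
    hF.comp_of_eq 0 (hc.prodMk hd) h0
  have h2 : HasDerivAt (fun ε => F (c ε, d ε))
      (td 𝓘(ℝ, ℝ) 𝓘(ℝ, ℝ) (fun ε => F (c ε, d ε)) 0 1) 0 := by
    have := hm.differentiableAt.hasFDerivAt.hasDerivAt
    rwa [← mfderiv_eq_fderiv] at this
  rw [h1, ContinuousLinearMap.comp_apply, ContinuousLinearMap.prod_apply, td_prod_apply hF] at h2
  exact h2

end TangentMap

/-! ### Discrete variational principles -/

section Variations

variable {E : Type*} [NormedAddCommGroup E] [NormedSpace ℝ E]

/-- Summation by parts: the endpoint terms drop out. -/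
theorem sum_add_shift_eq_zero_iff (n : ℕ) (A B : ℕ → E →ₗ[ℝ] ℝ) :
    (∀ v : ℕ → E, v 0 = 0 → v n = 0 → ∑ k ∈ Finset.range n, (A k (v k) + B k (v (k + 1))) = 0) ↔
      ∀ k, k + 1 < n → ∀ w, B k w + A (k + 1) w = 0 := by
  rcases n with _ | m
  · simp
  have key : ∀ v : ℕ → E, v 0 = 0 → v (m + 1) = 0 →
      ∑ k ∈ Finset.range (m + 1), (A k (v k) + B k (v (k + 1)))
        = ∑ k ∈ Finset.range m, (B k (v (k + 1)) + A (k + 1) (v (k + 1))) := by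
    intro v h0 h1
    rw [Finset.sum_add_distrib, Finset.sum_range_succ', Finset.sum_range_succ, h0, h1, map_zero,
      map_zero, add_zero, add_zero, ← Finset.sum_add_distrib]
    exact Finset.sum_congr rfl fun _ _ => add_comm _ _
  constructor
  · -- vary the single interior point `k + 1`
    intro h k hk w
    have h0 : (Pi.single (k + 1) w : ℕ → E) 0 = 0 := by simp
    have h1 : (Pi.single (k + 1) w : ℕ → E) (m + 1) = 0 := by
      rw [Pi.single_apply, if_neg]; omega
    have := h _ h0 h1
    rw [key _ h0 h1, Finset.sum_eq_single k] at this
    · simpa using this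
    · intro j _ hj
      simp [hj]
    · intro hk'
      exact absurd (Finset.mem_range.2 (by omega)) hk'
  · intro h v h0 h1
    rw [key v h0 h1]
    exact Finset.sum_eq_zero fun k hk => h k (by have := Finset.mem_range.1 hk; omega) _

variable {M : Type*} [TopologicalSpace M] [ChartedSpace E M]

theorem IsVariation.mdifferentiableAt {n : ℕ} {x : ℕ → M} {c : ℕ → ℝ → M}
    (hc : IsVariation E n x c) {k : ℕ} (hk : k ≤ n) :
    MDifferentiableAt 𝓘(ℝ, ℝ) 𝓘(ℝ, E) (c k) 0 := by
  obtain ⟨r, hr, h⟩ := hc.smooth k hk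
  exact (h.contMDiffAt (Ioo_mem_nhds (by linarith) hr)).mdifferentiableAt (by simp)

theorem exists_isVariation [IsManifold 𝓘(ℝ, E) ∞ M]
    (n : ℕ) (x : ℕ → M) (v : ℕ → E) (h0 : v 0 = 0) (hn : v n = 0) :
    ∃ c : ℕ → ℝ → M, IsVariation E n x c ∧ ∀ k, td 𝓘(ℝ, ℝ) 𝓘(ℝ, E) (c k) 0 1 = v k := by
  choose c hc using fun k => exists_curve_td_eq (x k) (v k)
  exact ⟨c, ⟨fun k _ => (hc k).2.1, fun k _ => (hc k).1, (hc 0).2.2.trans h0,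
    (hc n).2.2.trans hn⟩, fun k => (hc k).2.2⟩

/-- Forced discrete Euler–Lagrange equations are equivalent to the forced variational principle. -/
theorem solvesDR_iff_solvesReducedPrinciple [IsManifold 𝓘(ℝ, E) ∞ M]
    {F : M × M → ℝ} (α : PairForm E M) {n : ℕ} {x : ℕ → M}
    (hF : ∀ k < n, MDifferentiableAt (𝓘(ℝ, E).prod 𝓘(ℝ, E)) 𝓘(ℝ, ℝ) F (x k, x (k + 1))) :
    SolvesDR E F α n x ↔ SolvesReducedPrinciple E F α n x := by
  let α' : ℕ → E × E →ₗ[ℝ] ℝ := fun k => α (x k) (x (k + 1))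
  let d₁ : ℕ → E →L[ℝ] ℝ := fun k => D₁ E F (x k) (x (k + 1))
  let d₂ : ℕ → E →L[ℝ] ℝ := fun k => D₂ E F (x k) (x (k + 1))
  let A : ℕ → E →ₗ[ℝ] ℝ := fun k => (d₁ k : E →ₗ[ℝ] ℝ) - α' k ∘ₗ LinearMap.inl ℝ E E
  let B : ℕ → E →ₗ[ℝ] ℝ := fun k => (d₂ k : E →ₗ[ℝ] ℝ) - α' k ∘ₗ LinearMap.inr ℝ E E
  have hA : ∀ k v, A k v = d₁ k v - α' k (v, 0) := fun k v => rfl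
  have hB : ∀ k v, B k v = d₂ k v - α' k (0, v) := fun k v => rfl
  have hsplit : ∀ k v w, α' k (v, w) = α' k (v, 0) + α' k (0, w) := fun k v w => by
    rw [← map_add, Prod.mk_add_mk, add_zero, zero_add]
  have hDR : SolvesDR E F α n x ↔ ∀ k, k + 1 < n → ∀ w, B k w + A (k + 1) w = 0 := by
    refine forall_congr' fun k => imp_congr_right fun _ => forall_congr' fun w => ?_
    change d₂ k w + d₁ (k + 1) w = α' k (0, w) + α' (k + 1) (w, 0)
      ↔ d₂ k w - α' k (0, w) + (d₁ (k + 1) w - α' (k + 1) (w, 0)) = 0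
    rw [← sub_eq_zero, add_sub_add_comm]
  rw [hDR, ← sum_add_shift_eq_zero_iff]
  have hder : ∀ c : ℕ → ℝ → M, IsVariation E n x c →
      HasDerivAt (fun ε : ℝ => ∑ k ∈ Finset.range n, F (c k ε, c (k + 1) ε))
        (∑ k ∈ Finset.range n, (d₁ k (td 𝓘(ℝ, ℝ) 𝓘(ℝ, E) (c k) 0 1)
          + d₂ k (td 𝓘(ℝ, ℝ) 𝓘(ℝ, E) (c (k + 1)) 0 1))) 0 := by
    intro c hc
    apply HasDerivAt.fun_sum
    intro k hk
    have hk := Finset.mem_range.1 hk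
    exact hasDerivAt_comp_prodMk (hF k hk) (hc.mdifferentiableAt hk.le) (hc.mdifferentiableAt hk)
      (hc.base k hk.le) (hc.base (k + 1) hk)
  have hform : ∀ c : ℕ → ℝ → M, IsVariation E n x c →
      ∑ k ∈ Finset.range n, α (c k 0) (c (k + 1) 0) (velocity E (c k), velocity E (c (k + 1)))
        = ∑ k ∈ Finset.range n, (α' k (td 𝓘(ℝ, ℝ) 𝓘(ℝ, E) (c k) 0 1, 0)
          + α' k (0, td 𝓘(ℝ, ℝ) 𝓘(ℝ, E) (c (k + 1)) 0 1)) := by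
    intro c hc
    refine Finset.sum_congr rfl fun k hk => ?_
    have hk := Finset.mem_range.1 hk
    rw [← hsplit]
    -- forget base points, so that `c k 0` can be replaced by `x k`
    change (α (c k 0) (c (k + 1) 0) : E × E →ₗ[ℝ] ℝ) _ = (α (x k) (x (k + 1)) : E × E →ₗ[ℝ] ℝ) _
    rw [hc.base k hk.le, hc.base (k + 1) hk]
    rfl
  constructor
  · intro h c hc
    have h1 := h (fun k => td 𝓘(ℝ, ℝ) 𝓘(ℝ, E) (c k) 0 1) hc.left_end hc.right_end
    have h2 := hder c hc
    rw [hform c hc]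
    convert! h2 using 1
    rw [eq_comm, ← sub_eq_zero, ← Finset.sum_sub_distrib]
    refine (Finset.sum_congr rfl fun k _ => ?_).trans h1
    rw [hA, hB]
    ring
  · intro h v h0 hn
    obtain ⟨c, hc, hcv⟩ := exists_isVariation n x v h0 hn
    have h1 := (hder c hc).unique (h c hc)
    rw [hform c hc, ← sub_eq_zero, ← Finset.sum_sub_distrib] at h1
    simp only [hcv] at h1
    rw [← h1]
    refine Finset.sum_congr rfl fun k _ => ?_
    rw [hA, hB]
    ring

theorem solvesDEL_iff_solvesDR_zero {F : M × M → ℝ} {n : ℕ} {x : ℕ → M} :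
    SolvesDEL E F n x ↔ SolvesDR E F (fun _ _ => 0) n x := by
  refine forall_congr' fun k => imp_congr_right fun _ => ?_
  rw [ContinuousLinearMap.ext_iff]
  refine forall_congr' fun v => ?_
  simp

theorem solvesHamilton_iff_solvesReducedPrinciple_zero {F : M × M → ℝ} {n : ℕ} {x : ℕ → M} :
    SolvesHamilton E F n x ↔ SolvesReducedPrinciple E F (fun _ _ => 0) n x := by
  simp [SolvesHamilton, SolvesReducedPrinciple]

theorem solvesDEL_iff_solvesHamilton [IsManifold 𝓘(ℝ, E) ∞ M]
    {F : M × M → ℝ} {n : ℕ} {x : ℕ → M}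
    (hF : ∀ k < n, MDifferentiableAt (𝓘(ℝ, E).prod 𝓘(ℝ, E)) 𝓘(ℝ, ℝ) F (x k, x (k + 1))) :
    SolvesDEL E F n x ↔ SolvesHamilton E F n x := by
  rw [solvesDEL_iff_solvesDR_zero, solvesHamilton_iff_solvesReducedPrinciple_zero,
    solvesDR_iff_solvesReducedPrinciple _ hF]

end Variations

/-! ### Derivatives depending on parameters -/

section ParametricDerivative

variable {E : Type*} [NormedAddCommGroup E] [NormedSpace ℝ E]
  {H : Type*} [TopologicalSpace H] {I : ModelWithCorners ℝ E H}
  {M : Type*} [TopologicalSpace M] [ChartedSpace H M] [IsManifold I ∞ M]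
  {E' : Type*} [NormedAddCommGroup E'] [NormedSpace ℝ E']
  {H' : Type*} [TopologicalSpace H'] {I' : ModelWithCorners ℝ E' H'}
  {N : Type*} [TopologicalSpace N] [ChartedSpace H' N] [IsManifold I' ∞ N]
  {V : Type*} [NormedAddCommGroup V] [NormedSpace ℝ V]

/-- The derivative at a fixed point of a vector-valued map depends smoothly on parameters. -/
theorem contMDiff_td_const {f : N → M → V}
    (hf : ContMDiff (I'.prod I) 𝓘(ℝ, V) ∞ (fun z : N × M => f z.1 z.2)) (x : M) :
    ContMDiff I' 𝓘(ℝ, E →L[ℝ] V) ∞ (fun y => td I 𝓘(ℝ, V) (f y) x) := by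
  intro y
  have : IsManifold I 1 M := IsManifold.of_le (n := ∞) (by simp)
  have := ContMDiffAt.mfderiv (m := ∞) (n := ∞) (x₀ := y) f (fun _ => x) (hf (y, x))
    contMDiffAt_const (by simp)
  convert! this using 1
  funext z
  -- the coordinate changes are trivial: both base points are `x`, and `V` is a vector space
  have e := inTangentCoordinates_eq (I := I) (I' := 𝓘(ℝ, V)) (x₀ := y) (x := z) (fun _ => x)
    (fun z => f z x) (fun z => td I 𝓘(ℝ, V) (f z) x) (mem_chart_source H x)
    (mem_chart_source V (f z x))
  refine Eq.trans ?_ e.symm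
  ext v
  rw [ContinuousLinearMap.comp_apply, ContinuousLinearMap.comp_apply,
    (tangentBundleCore I M).coordChange_self _ _ (mem_chart_source H x),
    tangentBundleCore_coordChange_model_space]
  rfl

end ParametricDerivative

/-! ### Free and proper smooth actions -/

section Orbits

variable {G Q : Type*} [CommGroup G] [MulAction G Q]

theorem proj_smul (g : G) (q : Q) : proj G (g • q) = proj G q :=
  Quotient.sound (MulAction.orbitRel_apply.2 (MulAction.mem_orbit q g))

theorem exists_smul_eq_of_proj_eq {a b : Q} (h : proj G a = proj G b) : ∃ g : G, g • b = a :=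
  MulAction.mem_orbit_iff.1 (MulAction.orbitRel_apply.1 (Quotient.exact h))

theorem phi_smul (g : G) (p : Q × Q) : phi G (g • p) = phi G p :=
  Prod.ext (proj_smul g p.1) (proj_smul g p.2)

end Orbits

section Action

variable {EG : Type*} [NormedAddCommGroup EG] [NormedSpace ℝ EG]
  {EQ : Type*} [NormedAddCommGroup EQ] [NormedSpace ℝ EQ]
  {ES : Type*} [NormedAddCommGroup ES] [NormedSpace ℝ ES]
  {G : Type*} [TopologicalSpace G] [ChartedSpace EG G] [CommGroup G]
  {Q : Type*} [TopologicalSpace Q] [ChartedSpace EQ Q] [MulAction G Q]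

variable (EG EQ G) in
/-- The infinitesimal generator map `ξ ↦ ξ_Q(q)`, with tangent spaces read in the model spaces. -/
noncomputable def gen (q : Q) : EG →L[ℝ] EQ := td 𝓘(ℝ, EG) 𝓘(ℝ, EQ) (fun g : G => g • q) 1

section Smooth

variable (EG EQ) in
theorem contMDiff_smul_right [ContMDiffSMul 𝓘(ℝ, EG) 𝓘(ℝ, EQ) ∞ G Q] (g : G) :
    ContMDiff 𝓘(ℝ, EQ) 𝓘(ℝ, EQ) ∞ (fun q : Q => g • q) :=
  (contMDiff_smul (I := 𝓘(ℝ, EG)) (I' := 𝓘(ℝ, EQ)) (n := ∞) (G := G) (M := Q)).comp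
    (contMDiff_const.prodMk contMDiff_id)

variable [ContMDiffSMul 𝓘(ℝ, EG) 𝓘(ℝ, EQ) ∞ G Q]

theorem contMDiff_smul_left (q : Q) :
    ContMDiff 𝓘(ℝ, EG) 𝓘(ℝ, EQ) ∞ (fun g : G => g • q) :=
  (contMDiff_smul (I := 𝓘(ℝ, EG)) (I' := 𝓘(ℝ, EQ)) (n := ∞) (G := G) (M := Q)).comp
    (contMDiff_id.prodMk contMDiff_const)

theorem td_smul_apply (q : Q) (ξ : EG) (w : EQ) :
    td (𝓘(ℝ, EG).prod 𝓘(ℝ, EQ)) 𝓘(ℝ, EQ) (fun z : G × Q => z.1 • z.2) (1, q) (ξ, w)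
      = gen EG EQ G q ξ + w := by
  rw [td_prod_apply ((contMDiff_smul (I := 𝓘(ℝ, EG)) (I' := 𝓘(ℝ, EQ)) (n := ∞)
    (G := G) (M := Q)).mdifferentiableAt (by simp))]
  simp only [one_smul, td_id]
  rfl

/-- A free action is infinitesimally free: along an integral curve `γ` through `1` of the
left-invariant vector field of `ξ`, the point `γ(t) • q` has velocity `γ(t)_* ξ_Q(q)`; if
`ξ_Q(q) = 0` it is constant, so that `γ` is constant too. -/
theorem gen_injective [CompleteSpace EG] [LieGroup 𝓘(ℝ, EG) ∞ G] [IsManifold 𝓘(ℝ, EQ) ∞ Q]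
    (hfree : ∀ (g : G) (q : Q), g • q = q → g = 1) (q : Q) :
    Function.Injective (gen EG EQ G q) := by
  rw [injective_iff_map_eq_zero]
  intro ξ hξ
  have : LieGroup 𝓘(ℝ, EG) (minSmoothness ℝ 3) G := by
    rw [minSmoothness_of_isRCLikeNormedField]; infer_instance
  have : IsManifold 𝓘(ℝ, EG) 1 G := IsManifold.of_le (n := ∞) (by simp)
  have : IsManifold 𝓘(ℝ, EQ) 1 Q := IsManifold.of_le (n := ∞) (by simp)
  have hmul : ∀ g : G, MDifferentiableAt 𝓘(ℝ, EG) 𝓘(ℝ, EG) (fun h : G => g * h) 1 := fun g =>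
    (contMDiff_mul_left (I := 𝓘(ℝ, EG)) (n := ∞)).mdifferentiableAt (by simp)
  let X : (g : G) → TangentSpace 𝓘(ℝ, EG) g :=
    mulInvariantVectorField (I := 𝓘(ℝ, EG)) (G := G) (ξ : GroupLieAlgebra 𝓘(ℝ, EG) G)
  have hX : ContMDiff 𝓘(ℝ, EG) 𝓘(ℝ, EG).tangent 1
      (fun g => (⟨g, X g⟩ : TangentBundle 𝓘(ℝ, EG) G)) :=
    (contMDiff_mulInvariantVectorField (I := 𝓘(ℝ, EG)) (G := G)
      (ξ : GroupLieAlgebra 𝓘(ℝ, EG) G)).of_le (by simp)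
  obtain ⟨γ, hγ0, hγ⟩ := exists_isMIntegralCurveAt_of_contMDiffAt_boundaryless 0 (hX 1)
  let Y : G → EG := X
  -- by equivariance `X` lies in the kernel of the derivative of the orbit map at every `g`
  have hYg : ∀ g : G, td 𝓘(ℝ, EG) 𝓘(ℝ, EQ) (fun h : G => h • q) g (Y g) = 0 := by
    intro g
    have h1 := td_comp_of_eq (x := (1 : G)) (y := g) (f := fun h : G => g * h)
      ((contMDiff_smul_left (EG := EG) (EQ := EQ) q).mdifferentiableAt (by simp)) (hmul g)
      (mul_one g)
    have h2 := td_comp_of_eq (x := (1 : G)) (y := q) (f := fun h : G => h • q)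
      ((contMDiff_smul_right EG EQ g).mdifferentiableAt (by simp))
      ((contMDiff_smul_left (EG := EG) (EQ := EQ) q).mdifferentiableAt (by simp)) (one_smul G q)
    simp only [mul_smul] at h1
    rw [h1] at h2
    have h3 := DFunLike.congr_fun h2 ξ
    simp only [ContinuousLinearMap.comp_apply] at h3
    change td 𝓘(ℝ, EG) 𝓘(ℝ, EQ) (fun h : G => h • q) g (td 𝓘(ℝ, EG) 𝓘(ℝ, EG) (fun h => g * h) 1 ξ)
      = td 𝓘(ℝ, EQ) 𝓘(ℝ, EQ) (fun x : Q => g • x) q (gen EG EQ G q ξ) at h3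
    rw [hξ, map_zero] at h3
    exact h3
  -- both `γ(t) • q` and the constant `q` are integral curves of the zero field
  let Z : (x : Q) → TangentSpace 𝓘(ℝ, EQ) x := fun _ => 0
  have hZ : ContMDiff 𝓘(ℝ, EQ) 𝓘(ℝ, EQ).tangent 1
      (fun x => (⟨x, Z x⟩ : TangentBundle 𝓘(ℝ, EQ) Q)) :=
    Bundle.contMDiff_zeroSection ℝ (TangentSpace 𝓘(ℝ, EQ) (M := Q))
  have hc1 : IsMIntegralCurveAt (I := 𝓘(ℝ, EQ)) (fun t => γ t • q) Z 0 := by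
    filter_upwards [hγ] with t ht
    have h1 := HasMFDerivAt.comp t
      ((contMDiff_smul_left (EG := EG) (EQ := EQ) q).mdifferentiableAt
        (x := γ t) (by simp)).hasMFDerivAt ht
    have e : (td 𝓘(ℝ, EG) 𝓘(ℝ, EQ) (fun h : G => h • q) (γ t)).comp
        (ContinuousLinearMap.smulRight (1 : ℝ →L[ℝ] ℝ) (Y (γ t)))
        = ContinuousLinearMap.smulRight (1 : ℝ →L[ℝ] ℝ) (0 : EQ) := by
      ext
      rw [ContinuousLinearMap.comp_apply, ContinuousLinearMap.smulRight_apply, map_smul, hYg]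
      simp
    exact e ▸ h1
  have hc2 : IsMIntegralCurveAt (I := 𝓘(ℝ, EQ)) (fun _ => q) Z 0 := by
    filter_upwards with t
    have h1 := hasMFDerivAt_const (I := 𝓘(ℝ, ℝ)) (I' := 𝓘(ℝ, EQ)) q t
    have e : (0 : ℝ →L[ℝ] EQ) = ContinuousLinearMap.smulRight (1 : ℝ →L[ℝ] ℝ) (0 : EQ) := by
      ext; simp
    exact e ▸ h1
  have heq := isMIntegralCurveAt_eventuallyEq_of_contMDiffAt_boundaryless (hZ _) hc1 hc2
    (by simp [hγ0])
  have hγ1 : γ =ᶠ[𝓝 0] fun _ => 1 := by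
    filter_upwards [heq] with t ht using hfree _ _ ht
  have hd : td 𝓘(ℝ, ℝ) 𝓘(ℝ, EG) γ 0 1 = Y (γ 0) := by
    have e : td 𝓘(ℝ, ℝ) 𝓘(ℝ, EG) γ 0
        = ContinuousLinearMap.smulRight (1 : ℝ →L[ℝ] ℝ) (Y (γ 0)) := hγ.hasMFDerivAt.mfderiv
    rw [e, ContinuousLinearMap.smulRight_apply]
    exact one_smul ℝ _
  rw [td_congr hγ1, td_const, hγ0] at hd
  have h1 : Y 1 = td 𝓘(ℝ, EG) 𝓘(ℝ, EG) (fun h : G => 1 * h) 1 ξ := rfl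
  simp only [one_mul, td_id] at h1
  exact h1.symm.trans hd.symm

end Smooth

section Proper

variable [ProperSMul G Q] 

theorem isClosedEmbedding_smul_pair (hfree : ∀ (g : G) (q : Q), g • q = q → g = 1) :
    IsClosedEmbedding (fun z : G × Q => (z.1 • z.2, z.2)) := by
  have hp := ProperSMul.isProperMap_smul_pair (G := G) (X := Q)
  refine .of_continuous_injective_isClosedMap hp.continuous ?_ hp.isClosedMap
  rintro ⟨g, a⟩ ⟨h, b⟩ hab
  simp only [Prod.mk.injEq] at hab
  obtain ⟨h1, rfl⟩ := hab
  have := hfree (h⁻¹ * g) a (by rw [mul_smul, h1, inv_smul_smul])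
  rw [inv_mul_eq_one] at this
  rw [this]

/-- For a free and proper action, a group element that moves some point near `q` to a point
near `q` is close to `1`. -/
theorem nhds_one_prod_eq_comap (hfree : ∀ (g : G) (q : Q), g • q = q → g = 1) (q : Q) :
    𝓝 ((1 : G), q) = comap (fun z : G × Q => (z.1 • z.2, z.2)) (𝓝 (q, q)) := by
  rw [(isClosedEmbedding_smul_pair hfree).isInducing.nhds_eq_comap, one_smul]

end Proper

section Quotient

variable [ChartedSpace ES (ShapeSpace G Q)] [ContMDiffSMul 𝓘(ℝ, EG) 𝓘(ℝ, EQ) ∞ G Q]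

theorem td_proj_gen (hS : IsQuotientManifold EQ ES G Q) (q : Q) (ξ : EG) :
    td 𝓘(ℝ, EQ) 𝓘(ℝ, ES) (proj G : Q → ShapeSpace G Q) q (gen EG EQ G q ξ) = 0 := by
  have h := td_comp_of_eq (x := (1 : G)) (y := q) (f := fun h : G => h • q)
    (g := (proj G : Q → ShapeSpace G Q))
    (hS.smooth.mdifferentiableAt (by simp))
    ((contMDiff_smul_left (EG := EG) (EQ := EQ) q).mdifferentiableAt (by simp)) (one_smul G q)
  simp only [proj_smul, td_const] at h
  exact (DFunLike.congr_fun h ξ).symm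

/-- The kernel of `Tπ` is vertical: with a local section `s` of `π`, a point `q'` near `q` is
`g(q') • s(π(q'))` where `g(q')` depends smoothly on `q'`, by properness and the inverse function
theorem; differentiate this identity. -/
theorem exists_gen_eq_of_td_proj_eq_zero [FiniteDimensional ℝ EG] [FiniteDimensional ℝ EQ]
    [FiniteDimensional ℝ ES] [LieGroup 𝓘(ℝ, EG) ∞ G] [IsManifold 𝓘(ℝ, EQ) ∞ Q] [ProperSMul G Q]
    (hfree : ∀ (g : G) (q : Q), g • q = q → g = 1)
    (hS : IsQuotientManifold EQ ES G Q) (q : Q) (w : EQ)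
    (hw : td 𝓘(ℝ, EQ) 𝓘(ℝ, ES) (proj G : Q → ShapeSpace G Q) q w = 0) :
    ∃ ξ : EG, gen EG EQ G q ξ = w := by
  have := hS.isManifold
  have : CompleteSpace EG := FiniteDimensional.complete ℝ EG
  have : CompleteSpace EQ := FiniteDimensional.complete ℝ EQ
  obtain ⟨s, hs, hs0, hsr⟩ := exists_contMDiffAt_rightInverse
    (hS.smooth.contMDiffAt (x := q)) (hS.submersion q)
  have hsp : ContMDiffAt 𝓘(ℝ, EQ) 𝓘(ℝ, EQ) ∞ (fun x : Q => s (proj G x)) q :=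
    hs.comp q hS.smooth.contMDiffAt
  -- `f` is an immersion at `(1, q)`; its local left inverse recovers `g` from `(g • b, b)`
  let f : G × Q → Q × Q := fun z => (z.1 • z.2, z.2)
  have hsm := contMDiff_smul (I := 𝓘(ℝ, EG)) (I' := 𝓘(ℝ, EQ)) (n := ∞) (G := G) (M := Q)
  have hf : ContMDiff (𝓘(ℝ, EG).prod 𝓘(ℝ, EQ)) (𝓘(ℝ, EQ).prod 𝓘(ℝ, EQ)) ∞ f :=
    hsm.prodMk contMDiff_snd
  have hf0 : f (1, q) = (q, q) := by simp [f]
  have hinj : Function.Injective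
      (td (𝓘(ℝ, EG).prod 𝓘(ℝ, EQ)) (𝓘(ℝ, EQ).prod 𝓘(ℝ, EQ)) f (1, q)) := by
    rw [td_prodMk (hsm.mdifferentiableAt (by simp)) (contMDiff_snd.mdifferentiableAt one_ne_zero),
      injective_iff_map_eq_zero]
    rintro ⟨ξ, v⟩ h
    rw [ContinuousLinearMap.prod_apply, td_smul_apply, td_snd] at h
    obtain ⟨h1, rfl : v = 0⟩ := Prod.mk_eq_zero.1 h
    rw [add_zero] at h1
    rw [(injective_iff_map_eq_zero _).1 (gen_injective hfree q) ξ h1]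
    rfl
  obtain ⟨ρ, hρ, hρl⟩ := exists_contMDiffAt_leftInverse (hf (1, q)) hinj
  rw [hf0] at hρ
  have hρ0 : ρ (q, q) = (1, q) := by
    have := hρl.self_of_nhds
    rwa [hf0] at this
  have hpair : Tendsto (fun x : Q => (x, s (proj G x))) (𝓝 q) (𝓝 (q, q)) := by
    have := (continuousAt_id (x := q)).prodMk hsp.continuousAt
    have h2 := this.tendsto
    simp only [id, hs0] at h2
    exact h2
  have hev : ∀ᶠ x in 𝓝 q, (ρ (x, s (proj G x))).1 • s (proj G x) = x := by
    -- properness: the pair with image `(x, s(π x))` is near `(1, q)`, so `ρ` recovers it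
    rw [nhds_one_prod_eq_comap hfree, eventually_comap] at hρl
    filter_upwards [hpair.eventually hρl,
      hS.smooth.continuous.continuousAt.tendsto.eventually hsr] with x hx1 hx2
    obtain ⟨g, hg⟩ := exists_smul_eq_of_proj_eq hx2.symm
    have h3 := hx1 (g, s (proj G x)) (by simp [hg])
    simp only [f, hg] at h3
    rw [h3]
    exact hg
  let γ : Q → G := fun x => (ρ (x, s (proj G x))).1
  have hγ0 : γ q = 1 := by simp [γ, hs0, hρ0]
  have hγ : MDifferentiableAt 𝓘(ℝ, EQ) 𝓘(ℝ, EG) γ q := by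
    have h1 : ContMDiffAt 𝓘(ℝ, EQ) (𝓘(ℝ, EG).prod 𝓘(ℝ, EQ)) ∞ (fun x => ρ (x, s (proj G x))) q :=
      ContMDiffAt.comp_of_eq hρ (contMDiffAt_id.prodMk hsp) (by simp [hs0])
    exact (contMDiffAt_fst.comp q h1).mdifferentiableAt (by simp)
  have hsd : MDifferentiableAt 𝓘(ℝ, EQ) 𝓘(ℝ, EQ) (fun x : Q => s (proj G x)) q :=
    hsp.mdifferentiableAt (by simp)
  have hD := td_comp_of_eq (y := ((1 : G), q)) (g := fun z : G × Q => z.1 • z.2)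
    (hsm.mdifferentiableAt (by simp)) (hγ.prodMk hsd) (by simp [hγ0, hs0])
  have hev' : (fun x => γ x • s (proj G x)) =ᶠ[𝓝 q] fun x => x := hev
  rw [td_congr hev', td_id, td_prodMk hγ hsd] at hD
  have hDw := DFunLike.congr_fun hD w
  rw [ContinuousLinearMap.comp_apply, ContinuousLinearMap.prod_apply, td_smul_apply,
    td_comp (hs.mdifferentiableAt (by simp)) (hS.smooth.mdifferentiableAt (by simp)),
    ContinuousLinearMap.comp_apply, hw, map_zero, add_zero] at hDw
  exact ⟨_, hDw.symm⟩

end Quotient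

end Action

/-! ### The discrete momentum map -/

section Momentum

variable {EG : Type*} [NormedAddCommGroup EG] [NormedSpace ℝ EG]
  {EQ : Type*} [NormedAddCommGroup EQ] [NormedSpace ℝ EQ]
  {ES : Type*} [NormedAddCommGroup ES] [NormedSpace ℝ ES]
  {G : Type*} [TopologicalSpace G] [ChartedSpace EG G] [CommGroup G]
  {Q : Type*} [TopologicalSpace Q] [ChartedSpace EQ Q] [MulAction G Q]
  {L : Q × Q → ℝ}

variable (EG G L) in
/-- The discrete momentum map, in the form `J_d(q₀, q₁) = d/dg|_{g = 1} L(q₀, g • q₁)`. -/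
noncomputable def momentum (p : Q × Q) : EG →L[ℝ] ℝ :=
  td 𝓘(ℝ, EG) 𝓘(ℝ, ℝ) (fun g : G => L (p.1, g • p.2)) 1

variable (EG G L) in
/-- The derivative of `J_d` in the second slot along the group orbit. -/
noncomputable def momentumDeriv (p : Q × Q) : EG →L[ℝ] EG →L[ℝ] ℝ :=
  td 𝓘(ℝ, EG) 𝓘(ℝ, EG →L[ℝ] ℝ) (fun g : G => momentum EG G L (p.1, g • p.2)) 1

theorem momentum_smul {Q : Type*} [MulAction G Q] {L : Q × Q → ℝ}
    (hinv : ∀ (g : G) (q₀ q₁ : Q), L (g • q₀, g • q₁) = L (q₀, q₁))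
    (h : G) (p : Q × Q) : momentum EG G L (h • p) = momentum EG G L p := by
  simp only [momentum, Prod.smul_fst, Prod.smul_snd, smul_comm _ h, hinv]

theorem momentumDeriv_smul {Q : Type*} [MulAction G Q] {L : Q × Q → ℝ}
    (hinv : ∀ (g : G) (q₀ q₁ : Q), L (g • q₀, g • q₁) = L (q₀, q₁))
    (h : G) (p : Q × Q) : momentumDeriv EG G L (h • p) = momentumDeriv EG G L p := by
  have : ∀ g : G, momentum EG G L ((h • p).1, g • (h • p).2) = momentum EG G L (p.1, g • p.2) := by
    intro g
    rw [← momentum_smul hinv h (p.1, g • p.2)]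
    simp only [Prod.smul_fst, Prod.smul_snd, Prod.smul_mk, smul_comm g h]
  simp only [momentumDeriv, this]

variable [ContMDiffSMul 𝓘(ℝ, EG) 𝓘(ℝ, EQ) ∞ G Q]

section Chain

variable {V : Type*} [NormedAddCommGroup V] [NormedSpace ℝ V] {f : Q × Q → V} {p : Q × Q}

theorem td_comp_smul (hf : MDifferentiableAt (𝓘(ℝ, EQ).prod 𝓘(ℝ, EQ)) 𝓘(ℝ, V) f p) (ξ : EG) :
    td 𝓘(ℝ, EG) 𝓘(ℝ, V) (fun g : G => f (g • p)) 1 ξ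
      = td (𝓘(ℝ, EQ).prod 𝓘(ℝ, EQ)) 𝓘(ℝ, V) f p (gen EG EQ G p.1 ξ, gen EG EQ G p.2 ξ) := by
  have h1 := (contMDiff_smul_left (EG := EG) (EQ := EQ) (G := G) p.1).mdifferentiableAt
    (x := 1) (by simp)
  have h2 := (contMDiff_smul_left (EG := EG) (EQ := EQ) (G := G) p.2).mdifferentiableAt
    (x := 1) (by simp)
  have h := td_comp_of_eq (f := fun g : G => (g • p.1, g • p.2)) hf (h1.prodMk h2) (by simp)
  rw [td_prodMk h1 h2] at h
  exact DFunLike.congr_fun h ξ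

theorem td_comp_smul_snd (hf : MDifferentiableAt (𝓘(ℝ, EQ).prod 𝓘(ℝ, EQ)) 𝓘(ℝ, V) f p) (ξ : EG) :
    td 𝓘(ℝ, EG) 𝓘(ℝ, V) (fun g : G => f (p.1, g • p.2)) 1 ξ
      = td (𝓘(ℝ, EQ).prod 𝓘(ℝ, EQ)) 𝓘(ℝ, V) f p (0, gen EG EQ G p.2 ξ) := by
  have h2 := (contMDiff_smul_left (EG := EG) (EQ := EQ) (G := G) p.2).mdifferentiableAt
    (x := 1) (by simp)
  have h := td_comp_of_eq (f := fun g : G => (p.1, g • p.2)) hf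
    (mdifferentiableAt_const.prodMk h2) (by simp)
  rw [td_prodMk mdifferentiableAt_const h2, td_const] at h
  exact DFunLike.congr_fun h ξ

end Chain

section Lagrangian

variable (hL : ContMDiff (𝓘(ℝ, EQ).prod 𝓘(ℝ, EQ)) 𝓘(ℝ, ℝ) ∞ L)

include hL

theorem td_lagrangian_smul (hinv : ∀ (g : G) (q₀ q₁ : Q), L (g • q₀, g • q₁) = L (q₀, q₁))
    (p : Q × Q) (ξ : EG) : td (𝓘(ℝ, EQ).prod 𝓘(ℝ, EQ)) 𝓘(ℝ, ℝ) L p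
      (gen EG EQ G p.1 ξ, gen EG EQ G p.2 ξ) = 0 := by
  rw [← td_comp_smul (hL.mdifferentiableAt (by simp))]
  have : ∀ g : G, L (g • p) = L p := fun g => hinv g p.1 p.2
  simp only [this, td_const]
  rfl

theorem td_lagrangian_gen_snd (p : Q × Q) (ξ : EG) :
    td (𝓘(ℝ, EQ).prod 𝓘(ℝ, EQ)) 𝓘(ℝ, ℝ) L p (0, gen EG EQ G p.2 ξ) = momentum EG G L p ξ := by
  rw [← td_comp_smul_snd (hL.mdifferentiableAt (by simp))]
  rfl

theorem Jd_eq_momentum (p : Q × Q) : Jd EG EQ G L p.1 p.2 = momentum EG G L p := by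
  refine ContinuousLinearMap.ext fun (ξ : EG) => ?_
  refine Eq.trans ?_ (td_lagrangian_gen_snd (EG := EG) (G := G) hL p ξ)
  rw [td_prod_apply (hL.mdifferentiableAt (by simp)), map_zero, zero_add]
  rfl

variable [LieGroup 𝓘(ℝ, EG) ∞ G] [IsManifold 𝓘(ℝ, EQ) ∞ Q]

theorem contMDiff_momentum :
    ContMDiff (𝓘(ℝ, EQ).prod 𝓘(ℝ, EQ)) 𝓘(ℝ, EG →L[ℝ] ℝ) ∞ (momentum EG G L) := by
  refine contMDiff_td_const (I := 𝓘(ℝ, EG)) (f := fun (p : Q × Q) (g : G) => L (p.1, g • p.2)) ?_ 1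
  refine hL.comp ((contMDiff_fst.comp contMDiff_fst).prodMk ?_)
  exact (contMDiff_smul (I := 𝓘(ℝ, EG)) (I' := 𝓘(ℝ, EQ)) (n := ∞) (G := G) (M := Q)).comp
    (contMDiff_snd.prodMk (contMDiff_snd.comp contMDiff_fst))

theorem contMDiff_momentum_smul_snd :
    ContMDiff ((𝓘(ℝ, EQ).prod 𝓘(ℝ, EQ)).prod 𝓘(ℝ, EG)) 𝓘(ℝ, EG →L[ℝ] ℝ) ∞
      (fun z : (Q × Q) × G => momentum EG G L (z.1.1, z.2 • z.1.2)) := by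
  refine (contMDiff_momentum hL).comp ((contMDiff_fst.comp contMDiff_fst).prodMk ?_)
  exact (contMDiff_smul (I := 𝓘(ℝ, EG)) (I' := 𝓘(ℝ, EQ)) (n := ∞) (G := G) (M := Q)).comp
    (contMDiff_snd.prodMk (contMDiff_snd.comp contMDiff_fst))

theorem continuous_momentumDeriv : Continuous (momentumDeriv EG G L) :=
  (contMDiff_td_const (I := 𝓘(ℝ, EG)) (I' := 𝓘(ℝ, EQ).prod 𝓘(ℝ, EQ))
    (f := fun (p : Q × Q) (g : G) => momentum EG G L (p.1, g • p.2))
    (contMDiff_momentum_smul_snd hL) 1).continuous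

theorem td_momentum_smul (hinv : ∀ (g : G) (q₀ q₁ : Q), L (g • q₀, g • q₁) = L (q₀, q₁))
    (p : Q × Q) (ξ : EG) : td (𝓘(ℝ, EQ).prod 𝓘(ℝ, EQ)) 𝓘(ℝ, EG →L[ℝ] ℝ) (momentum EG G L) p
      (gen EG EQ G p.1 ξ, gen EG EQ G p.2 ξ) = 0 := by
  rw [← td_comp_smul ((contMDiff_momentum hL).mdifferentiableAt (by simp))]
  simp only [momentum_smul hinv, td_const]
  rfl

theorem td_momentum_gen_snd (p : Q × Q) (ξ : EG) :
    td (𝓘(ℝ, EQ).prod 𝓘(ℝ, EQ)) 𝓘(ℝ, EG →L[ℝ] ℝ) (momentum EG G L) p (0, gen EG EQ G p.2 ξ)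
      = momentumDeriv EG G L p ξ := by
  rw [← td_comp_smul_snd ((contMDiff_momentum hL).mdifferentiableAt (by simp))]
  rfl

/-- On the diagonal, the derivative of `J_d` along the orbit is minus the form `D₂D₁L` on
vertical vectors, because `J_d(q₀, q₁)·ξ = -D₁L(q₀, q₁)·ξ_Q(q₀)` by invariance. -/
theorem momentumDeriv_diag (hinv : ∀ (g : G) (q₀ q₁ : Q), L (g • q₀, g • q₁) = L (q₀, q₁))
    (q : Q) (ξ η : EG) :
    momentumDeriv EG G L (q, q) η ξ
      = - D₂D₁ EQ L q q (gen EG EQ G q ξ : EQ) (gen EG EQ G q η : EQ) := by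
  -- `d b = D₁L(q, b)`, which varies smoothly in the fixed vector space of linear forms
  let d : Q → EQ →L[ℝ] ℝ := fun b => td 𝓘(ℝ, EQ) 𝓘(ℝ, ℝ) (fun a => L (a, b)) q
  have hd : ContMDiff 𝓘(ℝ, EQ) 𝓘(ℝ, EQ →L[ℝ] ℝ) ∞ d :=
    contMDiff_td_const (I := 𝓘(ℝ, EQ)) (I' := 𝓘(ℝ, EQ)) (f := fun (b : Q) (a : Q) => L (a, b))
      (hL.comp (contMDiff_snd.prodMk contMDiff_fst)) q
  have hdq : MDifferentiableAt 𝓘(ℝ, EQ) 𝓘(ℝ, EQ →L[ℝ] ℝ) d q := hd.mdifferentiableAt (by simp)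
  have hmom : ∀ b : Q, momentum EG G L (q, b) ξ
      = (-(ContinuousLinearMap.apply ℝ ℝ (gen EG EQ G q ξ))) (d b) := by
    intro b
    have h1 := td_lagrangian_smul hL hinv (q, b) ξ
    have h2 := td_lagrangian_gen_snd (G := G) hL (q, b) ξ
    rw [td_prod_apply (hL.mdifferentiableAt (by simp))] at h1 h2
    rw [map_zero, zero_add] at h2
    rw [h2] at h1
    exact eq_neg_of_add_eq_zero_right h1
  have hsmul : MDifferentiableAt 𝓘(ℝ, EG) 𝓘(ℝ, EQ) (fun g : G => g • q) 1 :=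
    (contMDiff_smul_left (EG := EG) (EQ := EQ) q).mdifferentiableAt (by simp)
  have hm : MDifferentiableAt 𝓘(ℝ, EG) 𝓘(ℝ, EG →L[ℝ] ℝ)
      (fun g : G => momentum EG G L (q, g • q)) 1 :=
    ((contMDiff_momentum hL).mdifferentiableAt (by simp)).comp_of_eq 1
      (mdifferentiableAt_const.prodMk hsmul) rfl
  have e1 := td_comp (mdifferentiableAt_clm (ContinuousLinearMap.apply ℝ ℝ ξ) _) hm
  have e2 := td_comp (f := fun g : G => d (g • q)) (x := 1)
    (mdifferentiableAt_clm (-(ContinuousLinearMap.apply ℝ ℝ (gen EG EQ G q ξ))) (d ((1 : G) • q)))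
    (hdq.comp_of_eq 1 hsmul (one_smul G q))
  have e3 := td_comp_of_eq hdq hsmul (one_smul G q)
  have e4 := td_comp (mdifferentiableAt_clm (ContinuousLinearMap.apply ℝ ℝ (gen EG EQ G q ξ)) _) hdq
  have e12 : (fun g : G => ContinuousLinearMap.apply ℝ ℝ ξ (momentum EG G L (q, g • q)))
      = fun g : G => (-(ContinuousLinearMap.apply ℝ ℝ (gen EG EQ G q ξ))) (d (g • q)) :=
    funext fun g => hmom (g • q)
  rw [e12] at e1
  have e5 := DFunLike.congr_fun (e1.symm.trans e2) η
  have e6 := DFunLike.congr_fun e4 (gen EG EQ G q η)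
  simp only [ContinuousLinearMap.comp_apply] at e5 e6
  rw [td_clm, td_clm, e3] at e5
  rw [td_clm] at e6
  exact e5.trans (congrArg Neg.neg e6.symm)

theorem momentumDeriv_diag_injective [CompleteSpace EG]
    (hfree : ∀ (g : G) (q : Q), g • q = q → g = 1)
    (hinv : ∀ (g : G) (q₀ q₁ : Q), L (g • q₀, g • q₁) = L (q₀, q₁))
    (hgreg : IsGroupRegular EG EQ G L) (q : Q) :
    Function.Injective (momentumDeriv EG G L (q, q)) := by
  rw [injective_iff_map_eq_zero]
  intro η hη
  refine (injective_iff_map_eq_zero _).1 (gen_injective (EQ := EQ) hfree q) η ?_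
  refine (hgreg q).2 (gen EG EQ G q η) ⟨η, rfl⟩ ?_
  rintro _ ⟨ξ : EG, rfl⟩
  have := momentumDeriv_diag hL hinv q ξ η
  rw [hη] at this
  exact neg_eq_zero.1 this.symm

end Lagrangian

end Momentum

/-! ### The neighbourhood of the diagonal -/

section Neighbourhood

variable {EG : Type*} [NormedAddCommGroup EG] [NormedSpace ℝ EG] [FiniteDimensional ℝ EG]
  {EQ : Type*} [NormedAddCommGroup EQ] [NormedSpace ℝ EQ]
  {ES : Type*} [NormedAddCommGroup ES] [NormedSpace ℝ ES]
  {G : Type*} [TopologicalSpace G] [ChartedSpace EG G] [CommGroup G]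
  {Q : Type*} [TopologicalSpace Q] [ChartedSpace EQ Q] [MulAction G Q]
  {L : Q × Q → ℝ} [ContMDiffSMul 𝓘(ℝ, EG) 𝓘(ℝ, EQ) ∞ G Q]
  [LieGroup 𝓘(ℝ, EG) ∞ G] [IsManifold 𝓘(ℝ, EQ) ∞ Q]

/-- Near a point of the diagonal, `J_d(q₀, ·)` is injective along group orbits. -/
theorem exists_nhds_momentum_injective [FiniteDimensional ℝ EQ] [ProperSMul G Q]
    (hL : ContMDiff (𝓘(ℝ, EQ).prod 𝓘(ℝ, EQ)) 𝓘(ℝ, ℝ) ∞ L)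
    (hfree : ∀ (g : G) (q : Q), g • q = q → g = 1) (q : Q)
    (hinj : Function.Injective (momentumDeriv EG G L (q, q))) :
    ∃ U : Set Q, IsOpen U ∧ q ∈ U ∧ ∀ a ∈ U, ∀ b ∈ U, ∀ h k : G, h • a ∈ U → k • b ∈ U →
      momentum EG G L (a, (h⁻¹ * k) • b) = momentum EG G L (a, b) → h⁻¹ * k = 1 := by
  have : IsTopologicalGroup G := topologicalGroup_of_lieGroup 𝓘(ℝ, EG) ∞
  -- `f` is an immersion at `((q, q), 1)`, hence injective near this point
  let f : (Q × Q) × G → (Q × Q) × (EG →L[ℝ] ℝ) :=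
    fun z => (z.1, momentum EG G L (z.1.1, z.2 • z.1.2))
  have hm := contMDiff_momentum_smul_snd (EG := EG) (G := G) hL
  have hf : ContMDiff ((𝓘(ℝ, EQ).prod 𝓘(ℝ, EQ)).prod 𝓘(ℝ, EG))
      ((𝓘(ℝ, EQ).prod 𝓘(ℝ, EQ)).prod 𝓘(ℝ, EG →L[ℝ] ℝ)) ∞ f := contMDiff_fst.prodMk hm
  have hfi : Function.Injective (td ((𝓘(ℝ, EQ).prod 𝓘(ℝ, EQ)).prod 𝓘(ℝ, EG))
      ((𝓘(ℝ, EQ).prod 𝓘(ℝ, EQ)).prod 𝓘(ℝ, EG →L[ℝ] ℝ)) f ((q, q), 1)) := by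
    rw [td_prodMk (contMDiff_fst.mdifferentiableAt one_ne_zero) (hm.mdifferentiableAt (by simp)),
      injective_iff_map_eq_zero]
    rintro ⟨w, ξ⟩ h
    rw [ContinuousLinearMap.prod_apply, td_fst, td_prod_apply (hm.mdifferentiableAt (by simp))] at h
    obtain ⟨rfl : w = 0, h1⟩ := Prod.mk_eq_zero.1 h
    rw [map_zero, zero_add] at h1
    rw [(injective_iff_map_eq_zero _).1 hinj ξ h1]
    rfl
  obtain ⟨ρ, -, hρ⟩ := exists_contMDiffAt_leftInverse (hf ((q, q), 1)) hfi
  obtain ⟨A, hA, V, hV, hAV⟩ := mem_nhds_prod_iff.1 hρ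
  obtain ⟨A₁, hA₁, A₂, hA₂, hA12⟩ := mem_nhds_prod_iff.1 hA
  have hdiv : Tendsto (fun z : G × G => z.1⁻¹ * z.2) (𝓝 (1, 1)) (𝓝 1) := by
    have : Continuous (fun z : G × G => z.1⁻¹ * z.2) := by fun_prop
    simpa using this.tendsto (1, 1)
  obtain ⟨V₁, hV₁, V₂, hV₂, hV12⟩ := mem_nhds_prod_iff.1 (hdiv hV)
  -- properness confines group elements that move points near `q` to points near `q`
  have hcl : Prod.fst ⁻¹' (V₁ ∩ V₂) ∈ 𝓝 ((1 : G), q) :=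
    continuous_fst.continuousAt.preimage_mem_nhds (inter_mem hV₁ hV₂)
  rw [nhds_one_prod_eq_comap hfree, mem_comap] at hcl
  obtain ⟨T, hT, hTV⟩ := hcl
  obtain ⟨T₁, hT₁, T₂, hT₂, hT12⟩ := mem_nhds_prod_iff.1 hT
  refine ⟨interior ((A₁ ∩ A₂) ∩ (T₁ ∩ T₂)), isOpen_interior, mem_interior_iff_mem_nhds.2
    (inter_mem (inter_mem hA₁ hA₂) (inter_mem hT₁ hT₂)), ?_⟩
  intro a ha b hb h k hha hkb he
  have ha := interior_subset ha
  have hb := interior_subset hb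
  have hha := interior_subset hha
  have hkb := interior_subset hkb
  have hh : h ∈ V₁ ∩ V₂ := hTV (show (h, a) ∈ _ from hT12 ⟨hha.2.1, ha.2.2⟩)
  have hk : k ∈ V₁ ∩ V₂ := hTV (show (k, b) ∈ _ from hT12 ⟨hkb.2.1, hb.2.2⟩)
  have hhk : h⁻¹ * k ∈ V := hV12 (show (h, k) ∈ _ from ⟨hh.1, hk.2⟩)
  have hab : (a, b) ∈ A := hA12 ⟨ha.1.1, hb.1.2⟩
  have e1 : ρ (f ((a, b), h⁻¹ * k)) = ((a, b), h⁻¹ * k) := hAV ⟨hab, hhk⟩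
  have e2 : ρ (f ((a, b), 1)) = ((a, b), 1) := hAV ⟨hab, mem_of_mem_nhds hV⟩
  have e3 : f ((a, b), h⁻¹ * k) = f ((a, b), 1) := by simp only [f, he, one_smul]
  rw [e3, e2] at e1
  exact (congrArg Prod.snd e1).symm

/-- Around the diagonal there is an invariant open neighbourhood on which `J_d(q₀, ·)` is injective
along group orbits. The local neighbourhoods are glued over a closed, locally finite refinement of
the cover of shape space that they induce. -/
theorem exists_isOpen_momentum_injective [FiniteDimensional ℝ EQ] [FiniteDimensional ℝ ES]
    [ProperSMul G Q] [SecondCountableTopology Q] [ChartedSpace ES (ShapeSpace G Q)]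
    (hL : ContMDiff (𝓘(ℝ, EQ).prod 𝓘(ℝ, EQ)) 𝓘(ℝ, ℝ) ∞ L)
    (hfree : ∀ (g : G) (q : Q), g • q = q → g = 1)
    (hS : IsQuotientManifold EQ ES G Q)
    (hinv : ∀ (g : G) (q₀ q₁ : Q), L (g • q₀, g • q₁) = L (q₀, q₁))
    (hinj : ∀ q : Q, Function.Injective (momentumDeriv EG G L (q, q))) :
    ∃ W : Set (Q × Q), IsOpen W ∧ (∀ q, (q, q) ∈ W) ∧ (∀ (g : G), ∀ p ∈ W, g • p ∈ W) ∧
      ∀ (a b : Q) (g : G), (a, b) ∈ W → (a, g • b) ∈ W →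
        momentum EG G L (a, g • b) = momentum EG G L (a, b) → g = 1 := by
  choose U hUo hqU hU using fun q => exists_nhds_momentum_injective hL hfree q (hinj q)
  have : T2Space (ShapeSpace G Q) := t2Space_quotient_mulAction_of_properSMul
  have : ProperSpace ES := FiniteDimensional.proper_real ES
  have : LocallyCompactSpace (ShapeSpace G Q) := ChartedSpace.locallyCompactSpace ES _
  have : SecondCountableTopology (ShapeSpace G Q) := ContinuousConstSMul.secondCountableTopology
  have hπ : IsOpenMap (proj G : Q → ShapeSpace G Q) :=
    MulAction.isOpenQuotientMap_quotientMk.isOpenMap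
  have hπc : Continuous (proj G : Q → ShapeSpace G Q) := hS.smooth.continuous
  obtain ⟨v, hvo, hvc, hvf, hvU⟩ := precise_refinement (fun q => proj G '' U q)
    (fun q => hπ _ (hUo q)) (by
      refine eq_univ_of_forall fun x => ?_
      obtain ⟨q, rfl⟩ := Quotient.exists_rep x
      exact mem_iUnion.2 ⟨q, q, hqU q, rfl⟩)
  obtain ⟨C, hCc, hCcl, hCv⟩ := exists_iUnion_eq_closed_subset hvo hvf.point_finite hvc
  -- `O i` is the orbit of `U i × U i`, and `W` consists of the pairs `(q₀, q₁)` that lie in `O i`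
  -- for every `i` with `π(q₀) ∈ C i`; `K i` collects the pairs that violate this for `i`
  let O : Q → Set (Q × Q) := fun i => {p | ∃ h : G, h • p.1 ∈ U i ∧ h • p.2 ∈ U i}
  have hO : ∀ i, IsOpen (O i) := by
    intro i
    have : O i = ⋃ h : G, {p : Q × Q | h • p.1 ∈ U i ∧ h • p.2 ∈ U i} := by
      ext; simp [O]
    rw [this]
    refine isOpen_iUnion fun h => ?_
    exact ((hUo i).preimage (continuous_fst.const_smul h)).inter
      ((hUo i).preimage (continuous_snd.const_smul h))
  let K : Q → Set (Q × Q) := fun i => (fun p : Q × Q => proj G p.1) ⁻¹' C i ∩ (O i)ᶜ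
  have hK : IsClosed (⋃ i, K i) := by
    refine LocallyFinite.isClosed_iUnion ?_ fun i =>
      ((hCcl i).preimage (hπc.comp continuous_fst)).inter (hO i).isClosed_compl
    refine LocallyFinite.subset (g := K) ?_ (fun i => Subset.rfl)
    exact ((hvf.subset hCv).preimage_continuous (hπc.comp continuous_fst)).subset
      fun i => inter_subset_left
  have hmem : ∀ p : Q × Q, p ∈ (⋃ i, K i)ᶜ ↔ ∀ i, proj G p.1 ∈ C i → p ∈ O i := by
    intro p
    simp [K]
  refine ⟨(⋃ i, K i)ᶜ, hK.isOpen_compl, ?_, ?_, ?_⟩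
  · intro q
    rw [hmem]
    intro i hi
    obtain ⟨u, hu, hqu⟩ := hvU i (hCv i hi)
    obtain ⟨g, hg⟩ := exists_smul_eq_of_proj_eq hqu
    exact ⟨g, by rwa [hg], by rwa [hg]⟩
  · intro g p hp
    rw [hmem] at hp ⊢
    intro i hi
    obtain ⟨h, h1, h2⟩ := hp i (by rwa [Prod.smul_fst, proj_smul] at hi)
    exact ⟨h * g⁻¹, by simpa [mul_smul] using h1, by simpa [mul_smul] using h2⟩
  · intro a b g hab hgab he
    rw [hmem] at hab hgab
    obtain ⟨i, hi⟩ : ∃ i, proj G a ∈ C i := mem_iUnion.1 (hCc ▸ mem_univ (proj G a))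
    obtain ⟨h, h1, h2⟩ := hab i hi
    obtain ⟨k, k1, k2⟩ := hgab i hi
    -- translate both pairs into `U i` and apply the local statement at `(h • a, h • b)`
    have e : (k * h⁻¹)⁻¹ * (k * g * h⁻¹) = g := by
      rw [mul_right_comm k g h⁻¹, inv_mul_cancel_left]
    have := hU i (h • a) h1 (h • b) h2 (k * h⁻¹) (k * g * h⁻¹) (by simpa [mul_smul] using k1)
      (by simpa [mul_smul] using k2) (by
        rw [e, smul_comm g h]
        exact (momentum_smul hinv h (a, g • b)).trans
          (he.trans (momentum_smul hinv h (a, b)).symm))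
    rwa [e] at this

end Neighbourhood

/-! ### Sections of the projection inside momentum levels -/

section Sections

section Projection

variable {EG : Type*} [NormedAddCommGroup EG] [NormedSpace ℝ EG]
  {EQ : Type*} [NormedAddCommGroup EQ] [NormedSpace ℝ EQ]
  {ES : Type*} [NormedAddCommGroup ES] [NormedSpace ℝ ES]
  {G : Type*} [CommGroup G] {Q : Type*} [MulAction G Q] {L : Q × Q → ℝ} {p : Q × Q}

theorem momentumDeriv_surjective [FiniteDimensional ℝ EG] [TopologicalSpace G] [ChartedSpace EG G]
    (hp : Function.Injective (momentumDeriv EG G L p)) :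
    Function.Surjective (momentumDeriv EG G L p) := by
  have h : Module.finrank ℝ EG = Module.finrank ℝ (EG →L[ℝ] ℝ) := by
    rw [← (LinearMap.toContinuousLinearMap (𝕜 := ℝ) (E := EG) (F' := ℝ)).finrank_eq]
    exact (Subspace.dual_finrank_eq (K := ℝ) (V := EG)).symm
  exact (LinearMap.injective_iff_surjective_of_finrank_eq_finrank
    (f := (momentumDeriv EG G L p : EG →ₗ[ℝ] EG →L[ℝ] ℝ)) h).1 hp

variable [TopologicalSpace Q] [ChartedSpace EQ Q] [ChartedSpace ES (ShapeSpace G Q)]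

theorem contMDiff_phi (hS : IsQuotientManifold EQ ES G Q) :
    ContMDiff (𝓘(ℝ, EQ).prod 𝓘(ℝ, EQ)) (𝓘(ℝ, ES).prod 𝓘(ℝ, ES)) ∞ (phi G : Q × Q → _) :=
  (hS.smooth.comp contMDiff_fst).prodMk (hS.smooth.comp contMDiff_snd)

theorem td_phi_apply (hS : IsQuotientManifold EQ ES G Q) (w : EQ × EQ) :
    td (𝓘(ℝ, EQ).prod 𝓘(ℝ, EQ)) (𝓘(ℝ, ES).prod 𝓘(ℝ, ES)) (phi G : Q × Q → _) p w
      = (td 𝓘(ℝ, EQ) 𝓘(ℝ, ES) (proj G : Q → ShapeSpace G Q) p.1 w.1,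
          td 𝓘(ℝ, EQ) 𝓘(ℝ, ES) (proj G : Q → ShapeSpace G Q) p.2 w.2) := by
  have h1 : ∀ q : Q, MDifferentiableAt 𝓘(ℝ, EQ) 𝓘(ℝ, ES) (proj G : Q → ShapeSpace G Q) q :=
    fun q => hS.smooth.mdifferentiableAt (by simp)
  have h2 : MDifferentiableAt (𝓘(ℝ, EQ).prod 𝓘(ℝ, EQ)) 𝓘(ℝ, EQ) (fun p : Q × Q => p.1) p :=
    mdifferentiableAt_fst
  have h3 : MDifferentiableAt (𝓘(ℝ, EQ).prod 𝓘(ℝ, EQ)) 𝓘(ℝ, EQ) (fun p : Q × Q => p.2) p :=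
    mdifferentiableAt_snd
  have := td_prodMk ((h1 p.1).comp p h2) ((h1 p.2).comp p h3)
  have h4 := td_comp (h1 p.1) h2
  have h5 := td_comp (h1 p.2) h3
  rw [td_fst] at h4
  rw [td_snd] at h5
  have h6 : td (𝓘(ℝ, EQ).prod 𝓘(ℝ, EQ)) (𝓘(ℝ, ES).prod 𝓘(ℝ, ES)) (phi G : Q × Q → _) p = _ := this
  rw [h6, ContinuousLinearMap.prod_apply]
  exact Prod.ext (DFunLike.congr_fun h4 w) (DFunLike.congr_fun h5 w)

end Projection

variable {EG : Type*} [NormedAddCommGroup EG] [NormedSpace ℝ EG] [FiniteDimensional ℝ EG]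
  {EQ : Type*} [NormedAddCommGroup EQ] [NormedSpace ℝ EQ]
  {ES : Type*} [NormedAddCommGroup ES] [NormedSpace ℝ ES]
  {G : Type*} [TopologicalSpace G] [ChartedSpace EG G] [CommGroup G]
  {Q : Type*} [TopologicalSpace Q] [ChartedSpace EQ Q] [MulAction G Q]
  {L : Q × Q → ℝ} [ContMDiffSMul 𝓘(ℝ, EG) 𝓘(ℝ, EQ) ∞ G Q]
  [LieGroup 𝓘(ℝ, EG) ∞ G] [IsManifold 𝓘(ℝ, EQ) ∞ Q] [ChartedSpace ES (ShapeSpace G Q)]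
  {p : Q × Q}

/-- `(π × π, J_d)` is a submersion where the derivative of `J_d` along the orbit is invertible. -/
theorem td_phi_momentum_surjective (hL : ContMDiff (𝓘(ℝ, EQ).prod 𝓘(ℝ, EQ)) 𝓘(ℝ, ℝ) ∞ L)
    (hS : IsQuotientManifold EQ ES G Q)
    (hp : Function.Injective (momentumDeriv EG G L p)) (v : ES × ES) (ν : EG →L[ℝ] ℝ) :
    ∃ w : EQ × EQ,
      td (𝓘(ℝ, EQ).prod 𝓘(ℝ, EQ)) (𝓘(ℝ, ES).prod 𝓘(ℝ, ES)) (phi G : Q × Q → _) p w = v ∧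
      td (𝓘(ℝ, EQ).prod 𝓘(ℝ, EQ)) 𝓘(ℝ, EG →L[ℝ] ℝ) (momentum EG G L) p w = ν := by
  obtain ⟨(w₀ : EQ), hw₀ : td 𝓘(ℝ, EQ) 𝓘(ℝ, ES) (proj G : Q → ShapeSpace G Q) p.1 w₀ = v.1⟩ :=
    hS.submersion p.1 v.1
  obtain ⟨(w₁ : EQ), hw₁ : td 𝓘(ℝ, EQ) 𝓘(ℝ, ES) (proj G : Q → ShapeSpace G Q) p.2 w₁ = v.2⟩ :=
    hS.submersion p.2 v.2
  obtain ⟨η, hη⟩ := momentumDeriv_surjective hp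
    (ν - td (𝓘(ℝ, EQ).prod 𝓘(ℝ, EQ)) 𝓘(ℝ, EG →L[ℝ] ℝ) (momentum EG G L) p (w₀, w₁))
  refine ⟨(w₀, w₁) + (0, gen EG EQ G p.2 η), ?_, ?_⟩
  · rw [map_add, td_phi_apply hS, td_phi_apply hS, hw₀, hw₁, map_zero, td_proj_gen hS]
    simp
  · rw [map_add, td_momentum_gen_snd hL, hη]
    abel

variable [FiniteDimensional ℝ EQ] [FiniteDimensional ℝ ES]

/-- Local smooth sections of `π × π` with values in a level set of `J_d`. -/
theorem exists_momentum_section (hL : ContMDiff (𝓘(ℝ, EQ).prod 𝓘(ℝ, EQ)) 𝓘(ℝ, ℝ) ∞ L)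
    (hS : IsQuotientManifold EQ ES G Q)
    (hp : Function.Injective (momentumDeriv EG G L p)) :
    ∃ σ : ShapeSpace G Q × ShapeSpace G Q → Q × Q,
      ContMDiffAt (𝓘(ℝ, ES).prod 𝓘(ℝ, ES)) (𝓘(ℝ, EQ).prod 𝓘(ℝ, EQ)) ∞ σ (phi G p) ∧
      σ (phi G p) = p ∧ ∀ᶠ y in 𝓝 (phi G p), phi G (σ y) = y ∧
        momentum EG G L (σ y) = momentum EG G L p := by
  have := hS.isManifold
  have : CompleteSpace EQ := FiniteDimensional.complete ℝ EQ
  have hφ := contMDiff_phi (Q := Q) hS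
  have hm := contMDiff_momentum (EG := EG) (G := G) hL
  have hsurj : Function.Surjective (td (𝓘(ℝ, EQ).prod 𝓘(ℝ, EQ))
      ((𝓘(ℝ, ES).prod 𝓘(ℝ, ES)).prod 𝓘(ℝ, EG →L[ℝ] ℝ))
      (fun z : Q × Q => (phi G z, momentum EG G L z)) p) := by
    rw [td_prodMk (hφ.mdifferentiableAt (by simp)) (hm.mdifferentiableAt (by simp))]
    rintro ⟨v, ν⟩
    obtain ⟨w, h1, h2⟩ := td_phi_momentum_surjective hL hS hp v ν
    exact ⟨w, Prod.ext h1 h2⟩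
  obtain ⟨σ, hσ, hσ0, hσr⟩ := exists_contMDiffAt_rightInverse ((hφ.prodMk hm) p) hsurj
  have hin : ContMDiffAt (𝓘(ℝ, ES).prod 𝓘(ℝ, ES)) ((𝓘(ℝ, ES).prod 𝓘(ℝ, ES)).prod 𝓘(ℝ, EG →L[ℝ] ℝ))
      ∞ (fun y => (y, momentum EG G L p)) (phi G p) := contMDiffAt_id.prodMk contMDiffAt_const
  refine ⟨fun y => σ (y, momentum EG G L p), ContMDiffAt.comp (phi G p) hσ hin, hσ0, ?_⟩
  filter_upwards [hin.continuousAt.tendsto.eventually hσr] with y hy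
  exact ⟨congrArg Prod.fst hy, congrArg Prod.snd hy⟩

theorem exists_gen_of_td_phi_eq_zero [ProperSMul G Q]
    (hfree : ∀ (g : G) (q : Q), g • q = q → g = 1)
    (hS : IsQuotientManifold EQ ES G Q) {w : EQ × EQ}
    (hw : td (𝓘(ℝ, EQ).prod 𝓘(ℝ, EQ)) (𝓘(ℝ, ES).prod 𝓘(ℝ, ES)) (phi G : Q × Q → _) p w = 0) :
    ∃ ξ η : EG, w = (gen EG EQ G p.1 ξ, gen EG EQ G p.2 η) := by
  rw [td_phi_apply hS] at hw
  obtain ⟨h1, h2⟩ := Prod.mk_eq_zero.1 hw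
  obtain ⟨ξ, hξ⟩ := exists_gen_eq_of_td_proj_eq_zero (EG := EG) hfree hS p.1 w.1 h1
  obtain ⟨η, hη⟩ := exists_gen_eq_of_td_proj_eq_zero (EG := EG) hfree hS p.2 w.2 h2
  exact ⟨ξ, η, by rw [hξ, hη]⟩

/-- The directions tangent to a level set of `J_d` in the kernel of `π × π` are those of the
diagonal action. -/
theorem exists_gen_of_td_phi_eq_zero_of_td_momentum_eq_zero [ProperSMul G Q]
    (hfree : ∀ (g : G) (q : Q), g • q = q → g = 1)
    (hL : ContMDiff (𝓘(ℝ, EQ).prod 𝓘(ℝ, EQ)) 𝓘(ℝ, ℝ) ∞ L)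
    (hinv : ∀ (g : G) (q₀ q₁ : Q), L (g • q₀, g • q₁) = L (q₀, q₁))
    (hS : IsQuotientManifold EQ ES G Q)
    (hp : Function.Injective (momentumDeriv EG G L p)) {w : EQ × EQ}
    (hw : td (𝓘(ℝ, EQ).prod 𝓘(ℝ, EQ)) (𝓘(ℝ, ES).prod 𝓘(ℝ, ES)) (phi G : Q × Q → _) p w = 0)
    (hwm : td (𝓘(ℝ, EQ).prod 𝓘(ℝ, EQ)) 𝓘(ℝ, EG →L[ℝ] ℝ) (momentum EG G L) p w = 0) :
    ∃ ξ : EG, w = (gen EG EQ G p.1 ξ, gen EG EQ G p.2 ξ) := by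
  obtain ⟨ξ, η, rfl⟩ := exists_gen_of_td_phi_eq_zero (EG := EG) hfree hS hw
  have e : (gen EG EQ G p.1 ξ, gen EG EQ G p.2 η)
      = (gen EG EQ G p.1 ξ, gen EG EQ G p.2 ξ) + (0, gen EG EQ G p.2 (η - ξ)) := by
    rw [map_sub, Prod.mk_add_mk, add_zero, add_sub_cancel]
  rw [e, map_add, td_momentum_smul hL hinv, td_momentum_gen_snd hL, zero_add] at hwm
  have := sub_eq_zero.1 ((injective_iff_map_eq_zero _).1 hp _ hwm)
  exact ⟨ξ, by rw [this]⟩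

end Sections

/-! ### Dropping the connection form -/

section Connection

theorem td_smul_pair_apply {EQ : Type*} [NormedAddCommGroup EQ] [NormedSpace ℝ EQ]
    {G : Type*} [CommGroup G] {Q : Type*} [TopologicalSpace Q] [ChartedSpace EQ Q] [MulAction G Q]
    {g : G}
    (hg : MDifferentiable 𝓘(ℝ, EQ) 𝓘(ℝ, EQ) (fun q' : Q => g • q')) (p : Q × Q) (w : EQ × EQ) :
    td (𝓘(ℝ, EQ).prod 𝓘(ℝ, EQ)) (𝓘(ℝ, EQ).prod 𝓘(ℝ, EQ)) (fun z : Q × Q => g • z) p w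
      = (td 𝓘(ℝ, EQ) 𝓘(ℝ, EQ) (fun q' : Q => g • q') p.1 w.1,
        td 𝓘(ℝ, EQ) 𝓘(ℝ, EQ) (fun q' : Q => g • q') p.2 w.2) :=
  DFunLike.congr_fun (mfderiv_prodMap (hg p.1) (hg p.2)) w

variable {EG : Type*} [NormedAddCommGroup EG] [NormedSpace ℝ EG]
  {EQ : Type*} [NormedAddCommGroup EQ] [NormedSpace ℝ EQ]
  {ES : Type*} [NormedAddCommGroup ES] [NormedSpace ℝ ES]
  {G : Type*} [TopologicalSpace G] [ChartedSpace EG G] [CommGroup G]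
  {Q : Type*} [TopologicalSpace Q] [ChartedSpace EQ Q] [MulAction G Q]
  [IsManifold 𝓘(ℝ, EQ) ∞ Q] {L : Q × Q → ℝ}
  (A : PrincipalConnection EG EQ G Q) (μ : EG →L[ℝ] ℝ)

/-- The `1`-form `𝔄_μ = ⟨μ, 𝔄⟩` at a point. -/
noncomputable def connectionForm (q : Q) : EQ →L[ℝ] ℝ := μ.comp (A.form q : EQ →L[ℝ] EG)

theorem connectionForm_gen (q : Q) (ξ : EG) : connectionForm A μ q (gen EG EQ G q ξ) = μ ξ :=
  congrArg μ (A.reproduces q ξ)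

theorem connectionForm_smul (g : G) (q : Q) (v : EQ) :
    connectionForm A μ (g • q) (td 𝓘(ℝ, EQ) 𝓘(ℝ, EQ) (fun q' : Q => g • q') q v)
      = connectionForm A μ q v :=
  congrArg μ (A.invariant g q v)

/-- The `1`-form `π₂^*𝔄_μ − π₁^*𝔄_μ` at a point. -/
noncomputable def connectionDiff (p : Q × Q) : EQ × EQ →ₗ[ℝ] ℝ :=
  (connectionForm A μ p.2 : EQ →ₗ[ℝ] ℝ) ∘ₗ LinearMap.snd ℝ EQ EQ
    - (connectionForm A μ p.1 : EQ →ₗ[ℝ] ℝ) ∘ₗ LinearMap.fst ℝ EQ EQ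

theorem connectionDiff_apply (p : Q × Q) (w : EQ × EQ) : connectionDiff A μ p w
    = connectionForm A μ p.2 w.2 - connectionForm A μ p.1 w.1 := rfl

theorem connectionDiff_gen (p : Q × Q) (ξ η : EG) :
    connectionDiff A μ p (gen EG EQ G p.1 ξ, gen EG EQ G p.2 η) = μ η - μ ξ := by
  rw [connectionDiff_apply, connectionForm_gen, connectionForm_gen]

variable [ChartedSpace ES (ShapeSpace G Q)]

variable (L) in
/-- The linear form `β` on `T_{φ(p)}(S × S)` pulls back to `𝒜` on vectors at `p` tangent to the
level set of `J_d`. -/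
def IsDroppedAt (β : ES × ES →ₗ[ℝ] ℝ) (p : Q × Q) : Prop :=
  ∀ w : EQ × EQ,
    td (𝓘(ℝ, EQ).prod 𝓘(ℝ, EQ)) 𝓘(ℝ, EG →L[ℝ] ℝ) (momentum EG G L) p w = 0 →
      β (td (𝓘(ℝ, EQ).prod 𝓘(ℝ, EQ)) (𝓘(ℝ, ES).prod 𝓘(ℝ, ES)) (phi G : Q × Q → _) p w)
        = connectionDiff A μ p w

variable {A μ} [ContMDiffSMul 𝓘(ℝ, EG) 𝓘(ℝ, EQ) ∞ G Q] [LieGroup 𝓘(ℝ, EG) ∞ G]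
  {p : Q × Q}

theorem isTangentToLevel_iff (hL : ContMDiff (𝓘(ℝ, EQ).prod 𝓘(ℝ, EQ)) 𝓘(ℝ, ℝ) ∞ L)
    {q₀ q₁ : Q} {w₀ w₁ : EQ} : IsTangentToLevel EG EQ G L q₀ q₁ w₀ w₁ ↔
      td (𝓘(ℝ, EQ).prod 𝓘(ℝ, EQ)) 𝓘(ℝ, EG →L[ℝ] ℝ) (momentum EG G L) (q₀, q₁) (w₀, w₁) = 0 := by
  rw [ContinuousLinearMap.ext_iff]
  refine forall_congr' fun (ξ : EG) => ?_
  have h : (fun p : Q × Q => Jd EG EQ G L p.1 p.2 ξ)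
      = fun p => ContinuousLinearMap.apply ℝ ℝ ξ (momentum EG G L p) :=
    funext fun p => DFunLike.congr_fun (Jd_eq_momentum hL p) ξ
  have h2 := td_comp (x := (q₀, q₁)) (mdifferentiableAt_clm (ContinuousLinearMap.apply ℝ ℝ ξ) _)
    ((contMDiff_momentum (EG := EG) (G := G) hL).mdifferentiableAt (by simp))
  rw [← h, td_clm] at h2
  have h3 := DFunLike.congr_fun h2 (w₀, w₁)
  exact Eq.congr_left h3

theorem isDroppedForm_iff (hL : ContMDiff (𝓘(ℝ, EQ).prod 𝓘(ℝ, EQ)) 𝓘(ℝ, ℝ) ∞ L)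
    (hS : IsQuotientManifold EQ ES G Q) {W : Set (Q × Q)} {α : PairForm ES (ShapeSpace G Q)} :
    IsDroppedForm EG EQ ES G L W μ A α ↔ ∀ p ∈ levelSet EG EQ G L W μ,
      IsDroppedAt (ES := ES) L A μ (α (proj G p.1) (proj G p.2)) p := by
  constructor
  · intro h p hp w hw
    rw [td_phi_apply hS]
    exact h p.1 p.2 hp w.1 w.2 ((isTangentToLevel_iff hL).2 hw)
  · intro h q₀ q₁ hp w₀ w₁ hw
    have := h (q₀, q₁) hp (w₀, w₁) ((isTangentToLevel_iff hL).1 hw)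
    rw [td_phi_apply hS] at this
    exact this

theorem IsDroppedAt.unique {β β' : ES × ES →ₗ[ℝ] ℝ} [FiniteDimensional ℝ EG]
    (hL : ContMDiff (𝓘(ℝ, EQ).prod 𝓘(ℝ, EQ)) 𝓘(ℝ, ℝ) ∞ L)
    (hS : IsQuotientManifold EQ ES G Q)
    (hp : Function.Injective (momentumDeriv EG G L p))
    (h : IsDroppedAt L A μ β p) (h' : IsDroppedAt L A μ β' p) : β = β' := by
  refine LinearMap.ext fun v => ?_
  obtain ⟨w, hw, hwm⟩ := td_phi_momentum_surjective hL hS hp v 0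
  rw [← hw, h w hwm, h' w hwm]

theorem exists_isDroppedAt [FiniteDimensional ℝ EG] [FiniteDimensional ℝ EQ]
    [FiniteDimensional ℝ ES] [ProperSMul G Q]
    (hfree : ∀ (g : G) (q : Q), g • q = q → g = 1)
    (hL : ContMDiff (𝓘(ℝ, EQ).prod 𝓘(ℝ, EQ)) 𝓘(ℝ, ℝ) ∞ L)
    (hinv : ∀ (g : G) (q₀ q₁ : Q), L (g • q₀, g • q₁) = L (q₀, q₁))
    (hS : IsQuotientManifold EQ ES G Q)
    (hp : Function.Injective (momentumDeriv EG G L p)) (A : PrincipalConnection EG EQ G Q)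
    (μ : EG →L[ℝ] ℝ) : ∃ β : ES × ES →ₗ[ℝ] ℝ, IsDroppedAt L A μ β p := by
  let T : EQ × EQ →ₗ[ℝ] ES × ES :=
    td (𝓘(ℝ, EQ).prod 𝓘(ℝ, EQ)) (𝓘(ℝ, ES).prod 𝓘(ℝ, ES)) (phi G : Q × Q → _) p
  let B : EQ × EQ →ₗ[ℝ] EG →L[ℝ] ℝ :=
    td (𝓘(ℝ, EQ).prod 𝓘(ℝ, EQ)) 𝓘(ℝ, EG →L[ℝ] ℝ) (momentum EG G L) p
  obtain ⟨R, hR⟩ := LinearMap.exists_rightInverse_of_surjective (T.prod B)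
    (LinearMap.range_eq_top.2 (by
      rintro ⟨v, ν⟩
      obtain ⟨w, h1, h2⟩ := td_phi_momentum_surjective hL hS hp v ν
      exact ⟨w, Prod.ext h1 h2⟩))
  -- `R (·, 0)` lifts vectors of `S × S` to vectors tangent to the level set
  have hRT : ∀ v, T (R (v, 0)) = v := fun v => congrArg Prod.fst (LinearMap.congr_fun hR (v, 0))
  have hRB : ∀ v, B (R (v, 0)) = 0 := fun v => congrArg Prod.snd (LinearMap.congr_fun hR (v, 0))
  refine ⟨connectionDiff A μ p ∘ₗ R ∘ₗ LinearMap.inl ℝ _ _, fun w hw => ?_⟩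
  obtain ⟨ξ, hξ⟩ := exists_gen_of_td_phi_eq_zero_of_td_momentum_eq_zero hfree hL hinv hS hp
    (w := w - R (T w, 0)) (by
      rw [map_sub, sub_eq_zero]; exact (hRT (T w)).symm) (by
      rw [map_sub, hw, zero_sub, neg_eq_zero]; exact hRB (T w))
  have h1 := congrArg (connectionDiff A μ p) hξ
  rw [connectionDiff_gen, sub_self, map_sub, sub_eq_zero] at h1
  exact h1.symm

theorem IsDroppedAt.smul {β : ES × ES →ₗ[ℝ] ℝ}
    (hL : ContMDiff (𝓘(ℝ, EQ).prod 𝓘(ℝ, EQ)) 𝓘(ℝ, ℝ) ∞ L)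
    (hinv : ∀ (g : G) (q₀ q₁ : Q), L (g • q₀, g • q₁) = L (q₀, q₁))
    (hS : IsQuotientManifold EQ ES G Q) (h : IsDroppedAt L A μ β p) (g : G) :
    IsDroppedAt L A μ β (g • p) := by
  intro w hw
  have hsm : MDifferentiableAt (𝓘(ℝ, EQ).prod 𝓘(ℝ, EQ)) (𝓘(ℝ, EQ).prod 𝓘(ℝ, EQ))
      (fun z : Q × Q => g⁻¹ • z) (g • p) :=
    (((contMDiff_smul_right EG EQ g⁻¹).comp contMDiff_fst).prodMk
      ((contMDiff_smul_right EG EQ g⁻¹).comp contMDiff_snd)).mdifferentiableAt (by simp)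
  have h1 := td_comp_of_eq (y := p) ((contMDiff_phi (Q := Q) hS).mdifferentiableAt (by simp)) hsm
    (inv_smul_smul g p)
  have h2 := td_comp_of_eq (y := p)
    ((contMDiff_momentum (EG := EG) (G := G) hL).mdifferentiableAt (by simp)) hsm
    (inv_smul_smul g p)
  simp only [phi_smul] at h1
  simp only [momentum_smul hinv] at h2
  have h1 := DFunLike.congr_fun h1 w
  have h2 := DFunLike.congr_fun h2 w
  rw [ContinuousLinearMap.comp_apply] at h1 h2
  refine (congrArg β h1).trans ((h _ (h2.symm.trans hw)).trans ?_)
  rw [td_smul_pair_apply fun q => (contMDiff_smul_right EG EQ g⁻¹).mdifferentiableAt (by simp),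
    connectionDiff_apply, connectionDiff_apply]
  have h3 := connectionForm_smul A μ g⁻¹ (g • p).1 w.1
  have h4 := connectionForm_smul A μ g⁻¹ (g • p).2 w.2
  rw [Prod.smul_fst, inv_smul_smul] at h3
  rw [Prod.smul_snd, inv_smul_smul] at h4
  exact congrArg₂ _ h4 h3

end Connection

/-! ### Reduced Lagrangian and discrete Routh equations -/

section LevelSet

variable {EG : Type*} [NormedAddCommGroup EG] [NormedSpace ℝ EG]
  {EQ : Type*} [NormedAddCommGroup EQ] [NormedSpace ℝ EQ]
  {G : Type*} [TopologicalSpace G] [ChartedSpace EG G] [CommGroup G]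
  {Q : Type*} [TopologicalSpace Q] [ChartedSpace EQ Q] [MulAction G Q]
  {L : Q × Q → ℝ} {W : Set (Q × Q)} {μ : EG →L[ℝ] ℝ}

theorem mem_levelSet_iff [ContMDiffSMul 𝓘(ℝ, EG) 𝓘(ℝ, EQ) ∞ G Q]
    (hL : ContMDiff (𝓘(ℝ, EQ).prod 𝓘(ℝ, EQ)) 𝓘(ℝ, ℝ) ∞ L) {p : Q × Q} :
    p ∈ levelSet EG EQ G L W μ ↔ p ∈ W ∧ momentum EG G L p = μ :=
  and_congr_right fun _ => Eq.congr_left (Jd_eq_momentum hL p)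

/-- Level set points in `W` over the same point of `S × S` lie on one orbit, if `J_d(q₀, ·)` is
injective along group orbits in `W`. -/
theorem exists_smul_eq_of_phi_eq [ContMDiffSMul 𝓘(ℝ, EG) 𝓘(ℝ, EQ) ∞ G Q]
    (hL : ContMDiff (𝓘(ℝ, EQ).prod 𝓘(ℝ, EQ)) 𝓘(ℝ, ℝ) ∞ L)
    (hinv : ∀ (g : G) (q₀ q₁ : Q), L (g • q₀, g • q₁) = L (q₀, q₁))
    (hWinv : ∀ (g : G), ∀ p ∈ W, g • p ∈ W)
    (hWinj : ∀ (a b : Q) (g : G), (a, b) ∈ W → (a, g • b) ∈ W →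
        momentum EG G L (a, g • b) = momentum EG G L (a, b) → g = 1)
    {p p' : Q × Q} (hp : p ∈ levelSet EG EQ G L W μ) (hp' : p' ∈ levelSet EG EQ G L W μ)
    (h : phi G p = phi G p') : ∃ g : G, g • p = p' := by
  obtain ⟨h0, h1⟩ := Prod.mk.inj h
  obtain ⟨g, hg⟩ := exists_smul_eq_of_proj_eq h0.symm
  obtain ⟨k, hk⟩ := exists_smul_eq_of_proj_eq h1.symm
  rw [mem_levelSet_iff hL] at hp hp'
  have e : p' = ((g • p).1, (k * g⁻¹) • (g • p).2) := by
    rw [Prod.smul_fst, Prod.smul_snd, hg, mul_smul, inv_smul_smul, hk]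
  have hgp := hWinv g p hp.1
  have := hWinj (g • p).1 (g • p).2 (k * g⁻¹) hgp (e ▸ hp'.1) (by
    rw [← e, hp'.2]
    exact ((momentum_smul hinv g p).trans hp.2).symm)
  refine ⟨g, ?_⟩
  rw [e, this, one_smul]

theorem reducedLagrangian_phi
    (hinv : ∀ (g : G) (q₀ q₁ : Q), L (g • q₀, g • q₁) = L (q₀, q₁))
    (hφ : ∀ p ∈ levelSet EG EQ G L W μ, ∀ p' ∈ levelSet EG EQ G L W μ,
      phi G p = phi G p' → ∃ g : G, g • p = p')
    {p : Q × Q} (hp : p ∈ levelSet EG EQ G L W μ) :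
    reducedLagrangian EG EQ G L W μ (phi G p) = L p := by
  refine Function.FactorsThrough.extend_apply
    (f := fun p : levelSet EG EQ G L W μ => phi G p.1) (g := fun p => L p.1) ?_ 0 ⟨p, hp⟩
  intro a b hab
  obtain ⟨g, hg⟩ := hφ a.1 a.2 b.1 b.2 hab
  change L a.1 = L b.1
  rw [← hg]
  exact (hinv g a.1.1 a.1.2).symm

end LevelSet

section Reduction

variable {EG : Type*} [NormedAddCommGroup EG] [NormedSpace ℝ EG] [FiniteDimensional ℝ EG]
  {EQ : Type*} [NormedAddCommGroup EQ] [NormedSpace ℝ EQ] [FiniteDimensional ℝ EQ]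
  {ES : Type*} [NormedAddCommGroup ES] [NormedSpace ℝ ES] [FiniteDimensional ℝ ES]
  {G : Type*} [TopologicalSpace G] [ChartedSpace EG G] [CommGroup G]
  {Q : Type*} [TopologicalSpace Q] [ChartedSpace EQ Q] [MulAction G Q]
  {L : Q × Q → ℝ} [ContMDiffSMul 𝓘(ℝ, EG) 𝓘(ℝ, EQ) ∞ G Q]
  [LieGroup 𝓘(ℝ, EG) ∞ G] [IsManifold 𝓘(ℝ, EQ) ∞ Q] [ChartedSpace ES (ShapeSpace G Q)]
  {W : Set (Q × Q)} {μ : EG →L[ℝ] ℝ}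

section Drop

variable (hL : ContMDiff (𝓘(ℝ, EQ).prod 𝓘(ℝ, EQ)) 𝓘(ℝ, ℝ) ∞ L)
  (hinv : ∀ (g : G) (q₀ q₁ : Q), L (g • q₀, g • q₁) = L (q₀, q₁))
  (hS : IsQuotientManifold EQ ES G Q)
  (hWreg : ∀ p ∈ W, Function.Injective (momentumDeriv EG G L p))
  (hφ : ∀ p ∈ levelSet EG EQ G L W μ, ∀ p' ∈ levelSet EG EQ G L W μ,
    phi G p = phi G p' → ∃ g : G, g • p = p')

include hL hS hWreg

/-- Sections of `π × π` with values in the level set in `W`. -/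
theorem exists_levelSet_section (hWo : IsOpen W) {p : Q × Q} (hp : p ∈ levelSet EG EQ G L W μ) :
    ∃ σ : ShapeSpace G Q × ShapeSpace G Q → Q × Q,
      ContMDiffAt (𝓘(ℝ, ES).prod 𝓘(ℝ, ES)) (𝓘(ℝ, EQ).prod 𝓘(ℝ, EQ)) ∞ σ (phi G p) ∧
      σ (phi G p) = p ∧ ∀ᶠ y in 𝓝 (phi G p), phi G (σ y) = y ∧
        σ y ∈ levelSet EG EQ G L W μ := by
  have hp' := (mem_levelSet_iff hL).1 hp
  obtain ⟨σ, hσ, hσ0, hσr⟩ := exists_momentum_section hL hS (hWreg p hp'.1)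
  refine ⟨σ, hσ, hσ0, ?_⟩
  have hW : ∀ᶠ y in 𝓝 (phi G p), σ y ∈ W := by
    apply hσ.continuousAt.eventually_mem
    rw [hσ0]
    exact hWo.mem_nhds hp'.1
  filter_upwards [hσr, hW] with y h1 h2
  exact ⟨h1.1, (mem_levelSet_iff hL).2 ⟨h2, h1.2.trans hp'.2⟩⟩

theorem isOpen_phi_image_levelSet (hWo : IsOpen W) :
    IsOpen (phi G '' levelSet EG EQ G L W μ) := by
  rw [isOpen_iff_mem_nhds]
  rintro _ ⟨p, hp, rfl⟩
  obtain ⟨σ, -, -, h⟩ := exists_levelSet_section hL hS hWreg hWo hp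
  filter_upwards [h] with y hy using ⟨σ y, hy.2, hy.1⟩

include hinv hφ

theorem reducedLagrangian_eventuallyEq (hWo : IsOpen W) {p : Q × Q}
    (hp : p ∈ levelSet EG EQ G L W μ) :
    ∃ σ : ShapeSpace G Q × ShapeSpace G Q → Q × Q,
      ContMDiffAt (𝓘(ℝ, ES).prod 𝓘(ℝ, ES)) (𝓘(ℝ, EQ).prod 𝓘(ℝ, EQ)) ∞ σ (phi G p) ∧
      σ (phi G p) = p ∧
      (∀ᶠ y in 𝓝 (phi G p), phi G (σ y) = y ∧ momentum EG G L (σ y) = momentum EG G L p) ∧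
      reducedLagrangian EG EQ G L W μ =ᶠ[𝓝 (phi G p)] fun y => L (σ y) := by
  obtain ⟨σ, hσ, hσ0, h⟩ := exists_levelSet_section hL hS hWreg hWo hp
  refine ⟨σ, hσ, hσ0, ?_, ?_⟩
  · filter_upwards [h] with y hy
    exact ⟨hy.1, ((mem_levelSet_iff hL).1 hy.2).2.trans ((mem_levelSet_iff hL).1 hp).2.symm⟩
  · filter_upwards [h] with y hy
    rw [← reducedLagrangian_phi hinv hφ hy.2, hy.1]

theorem contMDiffAt_reducedLagrangian (hWo : IsOpen W) {p : Q × Q}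
    (hp : p ∈ levelSet EG EQ G L W μ) :
    ContMDiffAt (𝓘(ℝ, ES).prod 𝓘(ℝ, ES)) 𝓘(ℝ, ℝ) ∞ (reducedLagrangian EG EQ G L W μ)
      (phi G p) := by
  obtain ⟨σ, hσ, hσ0, -, h⟩ := reducedLagrangian_eventuallyEq hL hinv hS hWreg hφ hWo hp
  exact (ContMDiffAt.comp (phi G p) (hL _) hσ).congr_of_eventuallyEq h

/-- The key identity: `dL - 𝒜` is the pullback of `dL̂ - 𝒜̂` at points of the level set, on all
vectors and not only on those tangent to the level set. Both sides vanish on the vertical vectors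
`(ξ_Q, η_Q)`, by invariance and because `J_d = μ`; modulo these every vector is the velocity of a
section of `π × π` inside the level set. -/
theorem td_lagrangian_sub_connectionDiff [ProperSMul G Q]
    (hfree : ∀ (g : G) (q : Q), g • q = q → g = 1) (hWo : IsOpen W)
    {A : PrincipalConnection EG EQ G Q} {β : ES × ES →ₗ[ℝ] ℝ} {p : Q × Q}
    (hp : p ∈ levelSet EG EQ G L W μ) (hβ : IsDroppedAt L A μ β p) (w : EQ × EQ) :
    td (𝓘(ℝ, EQ).prod 𝓘(ℝ, EQ)) 𝓘(ℝ, ℝ) L p w - connectionDiff A μ p w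
      = td (𝓘(ℝ, ES).prod 𝓘(ℝ, ES)) 𝓘(ℝ, ℝ) (reducedLagrangian EG EQ G L W μ) (phi G p)
          (td (𝓘(ℝ, EQ).prod 𝓘(ℝ, EQ)) (𝓘(ℝ, ES).prod 𝓘(ℝ, ES)) (phi G : Q × Q → _) p w)
        - β (td (𝓘(ℝ, EQ).prod 𝓘(ℝ, EQ)) (𝓘(ℝ, ES).prod 𝓘(ℝ, ES)) (phi G : Q × Q → _) p w) := by
  obtain ⟨σ, hσ, hσ0, hσr, hσL⟩ := reducedLagrangian_eventuallyEq hL hinv hS hWreg hφ hWo hp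
  set v := td (𝓘(ℝ, EQ).prod 𝓘(ℝ, EQ)) (𝓘(ℝ, ES).prod 𝓘(ℝ, ES)) (phi G : Q × Q → _) p w with hv
  have hσd := hσ.mdifferentiableAt (by simp)
  set u := td (𝓘(ℝ, ES).prod 𝓘(ℝ, ES)) (𝓘(ℝ, EQ).prod 𝓘(ℝ, EQ)) σ (phi G p) v with hu
  have h1 := td_comp_of_eq ((contMDiff_phi (Q := Q) hS).mdifferentiableAt (by simp)) hσd hσ0
  have h2 := td_comp_of_eq
    ((contMDiff_momentum (EG := EG) (G := G) hL).mdifferentiableAt (by simp)) hσd hσ0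
  have h3 := td_comp_of_eq (hL.mdifferentiableAt (by simp)) hσd hσ0
  have e1 : (fun y => phi G (σ y)) =ᶠ[𝓝 (phi G p)] fun y => y := hσr.mono fun y hy => hy.1
  have e2 : (fun y => momentum EG G L (σ y)) =ᶠ[𝓝 (phi G p)] fun _ => momentum EG G L p :=
    hσr.mono fun y hy => hy.2
  rw [td_congr e1, td_id] at h1
  rw [td_congr e2, td_const] at h2
  rw [← td_congr hσL] at h3
  have hu1 := DFunLike.congr_fun h1 v
  have hu2 := DFunLike.congr_fun h2 v
  have hu3 := DFunLike.congr_fun h3 v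
  rw [ContinuousLinearMap.comp_apply, ← hu] at hu1 hu2 hu3
  have hβu := hβ u hu2.symm
  rw [← hu1] at hβu
  obtain ⟨ξ, η, hw⟩ := exists_gen_of_td_phi_eq_zero (EG := EG) hfree hS (w := w - u) (by
    rw [map_sub, ← hu1, hv]
    exact sub_self _)
  -- vertical part: by invariance only the second slot counts, where `dL` is `J_d = μ`
  have hvert : td (𝓘(ℝ, EQ).prod 𝓘(ℝ, EQ)) 𝓘(ℝ, ℝ) L p (w - u) = connectionDiff A μ p (w - u) := by
    have e : (gen EG EQ G p.1 ξ, gen EG EQ G p.2 η)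
        = (gen EG EQ G p.1 ξ, gen EG EQ G p.2 ξ) + (0, gen EG EQ G p.2 (η - ξ)) := by
      rw [map_sub, Prod.mk_add_mk, add_zero, add_sub_cancel]
    rw [hw, connectionDiff_gen, e, map_add, td_lagrangian_smul hL hinv, td_lagrangian_gen_snd hL,
      zero_add, ((mem_levelSet_iff hL).1 hp).2, map_sub]
  rw [map_sub, map_sub] at hvert
  have hid : (ContinuousLinearMap.id ℝ (ES × ES)) v = v := rfl
  rw [hid] at hβu
  rw [hu3, hβu]
  linarith

end Drop

/-- `𝒜` drops to a `1`-form: choose a lift of each point of `S × S`; another lift lies on the same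
orbit, along which `𝒜` is invariant. -/
theorem isDroppedForm_reducedForm [ProperSMul G Q]
    (hfree : ∀ (g : G) (q : Q), g • q = q → g = 1)
    (hL : ContMDiff (𝓘(ℝ, EQ).prod 𝓘(ℝ, EQ)) 𝓘(ℝ, ℝ) ∞ L)
    (hinv : ∀ (g : G) (q₀ q₁ : Q), L (g • q₀, g • q₁) = L (q₀, q₁))
    (hS : IsQuotientManifold EQ ES G Q)
    (hWreg : ∀ p ∈ W, Function.Injective (momentumDeriv EG G L p))
    (hφ : ∀ p ∈ levelSet EG EQ G L W μ, ∀ p' ∈ levelSet EG EQ G L W μ,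
      phi G p = phi G p' → ∃ g : G, g • p = p') (A : PrincipalConnection EG EQ G Q) :
    IsDroppedForm EG EQ ES G L W μ A (reducedForm EG EQ ES G L W μ A) := by
  classical
  have hex : ∃ α, IsDroppedForm EG EQ ES G L W μ A α := by
    have hloc : ∀ x : ShapeSpace G Q × ShapeSpace G Q, ∃ β : ES × ES →ₗ[ℝ] ℝ,
        ∀ p ∈ levelSet EG EQ G L W μ, phi G p = x → IsDroppedAt L A μ β p := by
      intro x
      by_cases h : ∃ p ∈ levelSet EG EQ G L W μ, phi G p = x
      · obtain ⟨p, hp, rfl⟩ := h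
        obtain ⟨β, hβ⟩ := exists_isDroppedAt hfree hL hinv hS (hWreg p hp.1) A μ
        refine ⟨β, fun p' hp' he => ?_⟩
        obtain ⟨g, rfl⟩ := hφ p hp p' hp' he.symm
        exact hβ.smul hL hinv hS g
      · exact ⟨0, fun p hp he => absurd ⟨p, hp, he⟩ h⟩
    choose β hβ using hloc
    exact ⟨fun a b => β (a, b), (isDroppedForm_iff hL hS).2 fun p hp => hβ _ p hp rfl⟩
  have h : reducedForm EG EQ ES G L W μ A = hex.choose := dif_pos hex
  exact h ▸ hex.choose_spec

theorem SolvesDR.congr {E : Type*} [NormedAddCommGroup E] [NormedSpace ℝ E]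
    {M : Type*} [TopologicalSpace M] [ChartedSpace E M] {F : M × M → ℝ} {α : PairForm E M}
    {n : ℕ} {x y : ℕ → M} (hxy : ∀ k ≤ n, x k = y k) (h : SolvesDR E F α n x) :
    SolvesDR E F α n y := by
  intro k hk
  rw [← hxy k (by omega), ← hxy (k + 1) (by omega), ← hxy (k + 2) (by omega)]
  exact h k hk

/-- Discrete Euler–Lagrange equations upstairs are the discrete Routh equations downstairs: add the
key identity for two consecutive pairs; the connection terms at the common point cancel. -/
theorem solvesDEL_iff_solvesDR [ProperSMul G Q]
    (hfree : ∀ (g : G) (q : Q), g • q = q → g = 1)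
    (hL : ContMDiff (𝓘(ℝ, EQ).prod 𝓘(ℝ, EQ)) 𝓘(ℝ, ℝ) ∞ L)
    (hinv : ∀ (g : G) (q₀ q₁ : Q), L (g • q₀, g • q₁) = L (q₀, q₁))
    (hS : IsQuotientManifold EQ ES G Q) (hWo : IsOpen W)
    (hWreg : ∀ p ∈ W, Function.Injective (momentumDeriv EG G L p))
    (hφ : ∀ p ∈ levelSet EG EQ G L W μ, ∀ p' ∈ levelSet EG EQ G L W μ,
      phi G p = phi G p' → ∃ g : G, g • p = p') {A : PrincipalConnection EG EQ G Q}
    {α : PairForm ES (ShapeSpace G Q)} (hα : IsDroppedForm EG EQ ES G L W μ A α) {n : ℕ}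
    {q : ℕ → Q} (hq : ∀ k < n, (q k, q (k + 1)) ∈ levelSet EG EQ G L W μ) :
    SolvesDEL EQ L n q ↔
      SolvesDR ES (reducedLagrangian EG EQ G L W μ) α n (fun k => proj G (q k)) := by
  have hkey : ∀ k, k + 1 < n → ∀ w : EQ,
      td 𝓘(ℝ, EQ) 𝓘(ℝ, ℝ) (fun b => L (q k, b)) (q (k + 1)) w
        + td 𝓘(ℝ, EQ) 𝓘(ℝ, ℝ) (fun a => L (a, q (k + 2))) (q (k + 1)) w
      = td 𝓘(ℝ, ES) 𝓘(ℝ, ℝ) (fun b => reducedLagrangian EG EQ G L W μ (proj G (q k), b))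
          (proj G (q (k + 1)))
          (td 𝓘(ℝ, EQ) 𝓘(ℝ, ES) (proj G : Q → ShapeSpace G Q) (q (k + 1)) w)
        + td 𝓘(ℝ, ES) 𝓘(ℝ, ℝ) (fun a => reducedLagrangian EG EQ G L W μ (a, proj G (q (k + 2))))
          (proj G (q (k + 1)))
          (td 𝓘(ℝ, EQ) 𝓘(ℝ, ES) (proj G : Q → ShapeSpace G Q) (q (k + 1)) w)
        - ((α (proj G (q k)) (proj G (q (k + 1))) : ES × ES →ₗ[ℝ] ℝ)
            (0, td 𝓘(ℝ, EQ) 𝓘(ℝ, ES) (proj G : Q → ShapeSpace G Q) (q (k + 1)) w)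
          + (α (proj G (q (k + 1))) (proj G (q (k + 2))) : ES × ES →ₗ[ℝ] ℝ)
            (td 𝓘(ℝ, EQ) 𝓘(ℝ, ES) (proj G : Q → ShapeSpace G Q) (q (k + 1)) w, 0)) := by
    intro k hk w
    have hα' := (isDroppedForm_iff hL hS).1 hα
    have hp := hq k (by omega)
    have hp' : (q (k + 1), q (k + 2)) ∈ levelSet EG EQ G L W μ := hq (k + 1) hk
    have h1 := td_lagrangian_sub_connectionDiff hL hinv hS hWreg hφ hfree hWo hp (hα' _ hp) (0, w)
    have h2 := td_lagrangian_sub_connectionDiff hL hinv hS hWreg hφ hfree hWo hp' (hα' _ hp') (w, 0)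
    have hd1 := (contMDiffAt_reducedLagrangian hL hinv hS hWreg hφ hWo hp).mdifferentiableAt
      (by simp)
    have hd2 := (contMDiffAt_reducedLagrangian hL hinv hS hWreg hφ hWo hp').mdifferentiableAt
      (by simp)
    rw [td_phi_apply hS, connectionDiff_apply, td_prod_apply (hL.mdifferentiableAt (by simp)),
      phi, td_prod_apply hd1] at h1
    rw [td_phi_apply hS, connectionDiff_apply, td_prod_apply (hL.mdifferentiableAt (by simp)),
      phi, td_prod_apply hd2] at h2
    simp only [map_zero, zero_add, add_zero, sub_zero, zero_sub, sub_neg_eq_add] at h1 h2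
    have hring : ∀ x y c a b d e : ℝ, x - c = a - b → y + c = d - e → x + y = a + d - (b + e) :=
      fun x y c a b d e h h' => by linarith
    exact hring _ _ _ _ _ _ _ h1 h2
  have hsurj : ∀ k, Function.Surjective
      (td 𝓘(ℝ, EQ) 𝓘(ℝ, ES) (proj G : Q → ShapeSpace G Q) (q k)) := fun k => hS.submersion (q k)
  refine forall_congr' fun k => forall_congr' fun hk => ?_
  constructor
  · intro h v
    obtain ⟨w, rfl⟩ := hsurj (k + 1) v
    have h1 := (hkey k hk w).symm.trans (DFunLike.congr_fun h w)
    exact sub_eq_zero.1 h1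
  · intro h
    refine ContinuousLinearMap.ext fun (w : EQ) => ?_
    exact (hkey k hk w).trans (sub_eq_zero.2 (h _))

end Reduction

end DiscreteRouth

/-! ### Discrete Routh reduction -/

open DiscreteRouth in
theorem theorem1
    {EG : Type*} [NormedAddCommGroup EG] [NormedSpace ℝ EG] [FiniteDimensional ℝ EG]
    {EQ : Type*} [NormedAddCommGroup EQ] [NormedSpace ℝ EQ] [FiniteDimensional ℝ EQ]
    {ES : Type*} [NormedAddCommGroup ES] [NormedSpace ℝ ES] [FiniteDimensional ℝ ES]
    -- an abelian Lie group
    {G : Type*} [TopologicalSpace G] [T2Space G] [SecondCountableTopology G]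
    [ChartedSpace EG G] [CommGroup G] [LieGroup 𝓘(ℝ, EG) ∞ G]
    -- a smooth configuration manifold
    {Q : Type*} [TopologicalSpace Q] [T2Space Q] [SecondCountableTopology Q]
    [ChartedSpace EQ Q] [IsManifold 𝓘(ℝ, EQ) ∞ Q]
    -- a smooth, free and proper action
    [MulAction G Q] [ContMDiffSMul 𝓘(ℝ, EG) 𝓘(ℝ, EQ) ∞ G Q] [ProperSMul G Q]
    (hfree : ∀ (g : G) (q : Q), g • q = q → g = 1)
    -- shape space with its quotient manifold structure
    [ChartedSpace ES (ShapeSpace G Q)] (hS : IsQuotientManifold EQ ES G Q)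
    -- the discrete Lagrangian
    (L : Q × Q → ℝ)
    (hL : ContMDiff (𝓘(ℝ, EQ).prod 𝓘(ℝ, EQ)) 𝓘(ℝ, ℝ) ∞ L)
    (hinv : ∀ (g : G) (q₀ q₁ : Q), L (g • q₀, g • q₁) = L (q₀, q₁))
    (hreg : IsRegular EQ L) (hgreg : IsGroupRegular EG EQ G L) :
    -- a `G`-invariant open neighbourhood `W` of the diagonal: "closely spaced" pairs
    ∃ W : Set (Q × Q), IsOpen W ∧ (∀ q : Q, (q, q) ∈ W) ∧
      (∀ (g : G) (q₀ q₁ : Q), (q₀, q₁) ∈ W → (g • q₀, g • q₁) ∈ W) ∧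
      ∀ μ : LieAlg EG G →L[ℝ] ℝ,
        -- `φ_μ` identifies `(W ∩ J_d⁻¹(μ)) / G` with an open subset of `S × S`
        (∀ p ∈ levelSet EG EQ G L W μ, ∀ p' ∈ levelSet EG EQ G L W μ,
          phi G p = phi G p' → ∃ g : G, g • p = p') ∧
        IsOpen (phi G '' levelSet EG EQ G L W μ) ∧
        -- `L` drops to a smooth function `L̂` there
        (∀ p ∈ levelSet EG EQ G L W μ,
          reducedLagrangian EG EQ G L W μ (phi G p) = L p) ∧
        ContMDiffOn (𝓘(ℝ, ES).prod 𝓘(ℝ, ES)) 𝓘(ℝ, ℝ) ∞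
          (reducedLagrangian EG EQ G L W μ) (phi G '' levelSet EG EQ G L W μ) ∧
        ∀ A : PrincipalConnection EG EQ G Q,
          -- `𝒜` drops to a unique `1`-form `𝒜̂` there
          IsDroppedForm EG EQ ES G L W μ A (reducedForm EG EQ ES G L W μ A) ∧
          (∀ α : PairForm ES (ShapeSpace G Q), IsDroppedForm EG EQ ES G L W μ A α →
            ∀ q₀ q₁ : Q, (q₀, q₁) ∈ levelSet EG EQ G L W μ →
              α (proj G q₀) (proj G q₁)
                = reducedForm EG EQ ES G L W μ A (proj G q₀) (proj G q₁)) ∧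
          -- the four equivalent statements
          ∀ (n : ℕ) (x : ℕ → ShapeSpace G Q) (q : ℕ → Q),
            (∀ k ≤ n, proj G (q k) = x k) →
            (∀ k < n, (q k, q (k + 1)) ∈ W ∧ Jd EG EQ G L (q k) (q (k + 1)) = μ) →
            List.TFAE
              [ SolvesDEL EQ L n q,
                SolvesHamilton EQ L n q,
                SolvesDR ES (reducedLagrangian EG EQ G L W μ)
                  (reducedForm EG EQ ES G L W μ A) n x,
                SolvesReducedPrinciple ES (reducedLagrangian EG EQ G L W μ)
                  (reducedForm EG EQ ES G L W μ A) n x ] := by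
  have : CompleteSpace EG := FiniteDimensional.complete ℝ EG
  have hdiag : ∀ q : Q, Function.Injective (momentumDeriv EG G L (q, q)) :=
    momentumDeriv_diag_injective hL hfree hinv hgreg
  obtain ⟨W', hWo', hWd', hWi', hWinj⟩ := exists_isOpen_momentum_injective hL hfree hS hinv hdiag
  let R : Set (Q × Q) := {p | Function.Injective (momentumDeriv EG G L p)}
  have hRo : IsOpen R :=
    ContinuousLinearMap.isOpen_injective.preimage (continuous_momentumDeriv hL)
  have hRi : ∀ (g : G), ∀ p ∈ R, g • p ∈ R := fun g p hp => by
    change Function.Injective (momentumDeriv EG G L (g • p))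
    rwa [momentumDeriv_smul hinv]
  have hWo : IsOpen (W' ∩ R) := hWo'.inter hRo
  have hWi : ∀ (g : G), ∀ p ∈ W' ∩ R, g • p ∈ W' ∩ R := fun g p hp =>
    ⟨hWi' g p hp.1, hRi g p hp.2⟩
  refine ⟨W' ∩ R, hWo, fun q => ⟨hWd' q, hdiag q⟩, fun g q₀ q₁ h => hWi g _ h, fun μ => ?_⟩
  have hφ : ∀ p ∈ levelSet EG EQ G L (W' ∩ R) μ, ∀ p' ∈ levelSet EG EQ G L (W' ∩ R) μ,
      phi G p = phi G p' → ∃ g : G, g • p = p' := fun p hp p' hp' h =>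
    exists_smul_eq_of_phi_eq hL hinv hWi (fun a b g h1 h2 => hWinj a b g h1.1 h2.1) hp hp' h
  have hWreg : ∀ p ∈ W' ∩ R, Function.Injective (momentumDeriv EG G L p) := fun p hp => hp.2
  have hsm : ∀ p ∈ levelSet EG EQ G L (W' ∩ R) μ, ContMDiffAt (𝓘(ℝ, ES).prod 𝓘(ℝ, ES)) 𝓘(ℝ, ℝ) ∞
      (reducedLagrangian EG EQ G L (W' ∩ R) μ) (phi G p) := fun p hp =>
    contMDiffAt_reducedLagrangian hL hinv hS hWreg hφ hWo hp
  refine ⟨hφ, isOpen_phi_image_levelSet hL hS hWreg hWo,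
    fun p hp => reducedLagrangian_phi hinv hφ hp, ?_, fun A => ?_⟩
  · rintro _ ⟨p, hp, rfl⟩
    exact (hsm p hp).contMDiffWithinAt
  have hA := isDroppedForm_reducedForm hfree hL hinv hS hWreg hφ A
  refine ⟨hA, fun α hα q₀ q₁ hp => ?_, fun n x q hx hq => ?_⟩
  · exact IsDroppedAt.unique (ES := ES) hL hS (hWreg _ hp.1) ((isDroppedForm_iff hL hS).1 hα _ hp)
      ((isDroppedForm_iff hL hS).1 hA _ hp)
  have := hS.isManifold
  tfae_have 1 ↔ 2 := solvesDEL_iff_solvesHamilton fun k _ => hL.mdifferentiableAt (by simp)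
  tfae_have 1 ↔ 3 := (solvesDEL_iff_solvesDR hfree hL hinv hS hWo hWreg hφ hA hq).trans
    ⟨SolvesDR.congr hx, SolvesDR.congr fun k hk => (hx k hk).symm⟩
  tfae_have 3 ↔ 4 := solvesDR_iff_solvesReducedPrinciple _ fun k hk => by
    rw [← hx k hk.le, ← hx (k + 1) hk]
    exact (hsm _ (hq k hk)).mdifferentiableAt (by simp)
  tfae_finish
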